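/- Let $$R^\sigma(x,t,u,\partial u,\dots,\partial^l u)=0,\qquad \sigma=1,\dots,s,\qquad (1)$$ be a PDE system of order $l\ge 1$ with two independent variables $(x,t)$ and $m\ge 1$ dependent variables $u=(u^1,\dots,u^m)$, the $R^\sigma$ being smooth functions on an open set of $l$-jets; solutions are smooth functions on open subsets of the plane. Suppose that (1) admits a point symmetry, i.e. a (local) one-parameter Lie group of point transformations of $(x,t,u)$-space that maps solutions to solutions (as long as their images are graphs of smooth functions whose jets stay in the domain of the $R^\sigma$), with infinitesimal generator $\mathbf X$. (a) Near each point where $\mathbf X\neq 0$ there are canonical coordinates, i.e. a smooth invertible change of variables $(x,t,u)\mapsto(X,T,U^1,\dots,U^m)$ with $\mathbf X X=\mathbf X T=0$, $\mathbf X U^1=1$, $\mathbf X U^i=0$ for $i=2,\dots,m$ (such that, for fixed $X,T,U^2,\dots,U^m$, the range of $U^1$ is an interval). (b) In any such canonical coordinates, (1) is invertibly equivalent to a smooth system of the form $$\hat R^\sigma(X,T,\hat U,\partial U,\dots,\partial^l U)=0,\quad \sigma=1,\dots,s,\qquad \hat U=(U^2,\dots,U^m),\qquad (2)$$ in which $U^1$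 itself does not occur. Here invertibly equivalent means: if the change of variables maps the graph of $u$ (with jets in the domain of the $R^\sigma$) onto the graph of $U$, then $u$ solves (1) if and only if $U$ solves (2); and every solution of (2) arises, locally and after adding a constant to $U^1$, from a solution of (1) in this way. (c) For every such form (2), let $\tilde R^\sigma$ be obtained from $\hat R^\sigma$ by substituting $\alpha=U^1_T$, $\beta=U^1_X$ (mixed derivatives of $U^1$ being expressed through $\alpha$ or through $\beta$ in any way). Then the inverse potential system $$\alpha_X=\beta_T,\qquad \tilde R^\sigma(X,T,\hat U,\alpha,\beta,\partial\hat U,\dots,\partial^{l-1}\alpha,\partial^{l-1}\beta,\partial^l\hat U)=0,\quad \sigma=1,\dots,s,\qquad (3)$$ is nonlocally related to (1) and (2), in the following sense. 1. Every solution $U$ of (2) yields the solution $(\alpha,\beta,\hat U)=(U^1_T,U^1_X,\hat U)$ of (3). Hence so does every solution $u$ of (1) whose graph is in the new coordinates the graph of a function $U(X,T)$, which is the case locally wherever $(X,T)$ can serve as independent variables on the graph of $u$. 2. On a simply connected domain, for each solution $(\alpha,\beta,\hat U)$ of (3) there is a function $h$ such that the solutions $U$ of (2) which yield it are exactly $(h+C,\hat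 U)$ with $C$ an arbitrary constant. Near each point, every solution of (3) is yielded by a one-parameter family of solutions of (1), whose members differ by additive constants in $U^1$. 3. Two solutions of (1) that become functions $U$ on the same connected $(X,T)$-domain yield the same solution of (3) if and only if they differ by an additive constant in $U^1$. The correspondence is not one-to-one: near every point of its domain, every solution of (3) is yielded by two solutions of (1) with disjoint graphs. 4. $U^1$ is not a local function of $X,T,\hat U,\alpha,\beta$ and their derivatives: for any $k$ and any function $F$ of the $k$-jet of $(\alpha,\beta,\hat U)$, and any solution of (1) that becomes $U$ on a non-empty domain, there is a solution of (1) that becomes $U$ with a constant added to $U^1$ on a subdomain, for which $U^1=F$ fails at some point. -/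

import Mathlib

open Set
open scoped ContDiff

noncomputable section

/-! ### Jets and PDE systems in two independent variables -/

/-- Partial derivative with respect to the first independent variable (`x`, resp. `X`). -/
def pdX (f : ℝ × ℝ → ℝ) : ℝ × ℝ → ℝ := fun p => fderiv ℝ f p (1, 0)

/-- Partial derivative with respect to the second independent variable (`t`, resp. `T`). -/
def pdT (f : ℝ × ℝ → ℝ) : ℝ × ℝ → ℝ := fun p => fderiv ℝ f p (0, 1)

/-- The mixed partial derivative `∂_X^i ∂_T^j f`. -/
def pd (i j : ℕ) (f : ℝ × ℝ → ℝ) : ℝ × ℝ → ℝ := pdX^[i] (pdT^[j] f)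

/-- Pairs `(i, j)` with `i + j ≤ l`: the partial derivatives `∂_X^i ∂_T^j` of order at most `l`. -/
abbrev MIdx (l : ℕ) : Type := {μ : Fin (l + 1) × Fin (l + 1) // (μ.1 : ℕ) + (μ.2 : ℕ) ≤ l}

/-- The space of independent and `k` dependent variables `(x, t, u¹, …, uᵏ)`. -/
abbrev Base (k : ℕ) : Type := (ℝ × ℝ) × (Fin k → ℝ)

/-- The jet space of order `l` for `k` dependent variables: the point `(x, t)` and a value for
each partial derivative of order at most `l` (order `0` included) of each dependent variable. -/
abbrev Jet (k l : ℕ) : Type := (ℝ × ℝ) × (Fin k → MIdx l → ℝ)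

/-- The `l`-jet of `u` at `p`. -/
def jet {k : ℕ} (l : ℕ) (u : ℝ × ℝ → Fin k → ℝ) (p : ℝ × ℝ) : Jet k l :=
  (p, fun a μ => pd μ.1.1 μ.1.2 (fun q => u q a) p)

/-- A system `R^σ(x, t, u, ∂u, …, ∂ˡu) = 0`, `σ = 1, …, s`, of order `l` with two independent and
`k` dependent variables; the smooth functions `R^σ` live on an open set of jets. -/
structure PDESystem (k l s : ℕ) where
  /-- the jets at which the system is defined -/
  dom : Set (Jet k l)
  isOpen_dom : IsOpen dom
  /-- the left-hand sides of the equations (only their values on `dom` matter) -/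
  R : Jet k l → Fin s → ℝ
  contDiffOn_R : ContDiffOn ℝ ∞ R dom

/-- `u` is a smooth solution of the system on the open set `D`. -/
def PDESystem.IsSolution {k l s : ℕ} (S : PDESystem k l s) (D : Set (ℝ × ℝ))
    (u : ℝ × ℝ → Fin k → ℝ) : Prop :=
  IsOpen D ∧ ContDiffOn ℝ ∞ u D ∧ ∀ p ∈ D, jet l u p ∈ S.dom ∧ S.R (jet l u p) = 0

/-- The graph of `u` over `D`. -/
def graphOver {k : ℕ} (D : Set (ℝ × ℝ)) (u : ℝ × ℝ → Fin k → ℝ) : Set (Base k) :=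
  (fun p => (p, u p)) '' D

/-! ### Point symmetries -/

/-- A (local) one-parameter Lie group of point transformations `z ↦ φ ε z` on an open set `M` of
the space of independent and dependent variables. `φ ε z` is defined for `(ε, z) ∈ flowDom`. -/
structure PointGroup (k : ℕ) where
  M : Set (Base k)
  isOpen_M : IsOpen M
  flowDom : Set (ℝ × Base k)
  isOpen_flowDom : IsOpen flowDom
  mem_of_flowDom : ∀ {ε z}, (ε, z) ∈ flowDom → z ∈ M
  zero_mem : ∀ z ∈ M, ((0 : ℝ), z) ∈ flowDom
  interval : ∀ z, OrdConnected {ε : ℝ | (ε, z) ∈ flowDom}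
  φ : ℝ → Base k → Base k
  smooth : ContDiffOn ℝ ∞ (fun w : ℝ × Base k => φ w.1 w.2) flowDom
  maps : ∀ {ε z}, (ε, z) ∈ flowDom → φ ε z ∈ M
  map_zero : ∀ z ∈ M, φ 0 z = z
  mul_mem : ∀ {δ ε z}, (δ, z) ∈ flowDom → (ε, φ δ z) ∈ flowDom → (ε + δ, z) ∈ flowDom
  map_mul : ∀ {δ ε z}, (δ, z) ∈ flowDom → (ε, φ δ z) ∈ flowDom → φ (ε + δ) z = φ ε (φ δ z)

/-- The infinitesimal generator
`ξ(x,t,u) ∂/∂x + τ(x,t,u) ∂/∂t + ∑ ηⁱ(x,t,u) ∂/∂uⁱ` of the group, as a vector field. -/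
def PointGroup.generator {k : ℕ} (G : PointGroup k) (z : Base k) : Base k :=
  deriv (fun ε => G.φ ε z) 0

/-- The group is a point symmetry of `S`: if a group element carries (the graph of) a solution
`u` to (the graph of) a smooth function `v`, then `v` is a solution, as long as it stays in the
region of jet space where the system is defined. -/
def IsPointSymmetry {k l s : ℕ} (G : PointGroup k) (S : PDESystem k l s) : Prop :=
  ∀ (ε : ℝ) (D D' : Set (ℝ × ℝ)) (u v : ℝ × ℝ → Fin k → ℝ),
    S.IsSolution D u → IsOpen D' → ContDiffOn ℝ ∞ v D' →
    (∀ z ∈ graphOver D u, (ε, z) ∈ G.flowDom) →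
    G.φ ε '' graphOver D u = graphOver D' v →
    (∀ p ∈ D', jet l v p ∈ S.dom) →
    S.IsSolution D' v

/-! ### Canonical coordinates and the transformed system -/

/-- The unit vector `∂/∂U¹` of the space `(X, T, U¹, …, Uᵐ)`, `m = n + 1`. -/
def eU (n : ℕ) : Base (n + 1) := (0, Pi.single 0 1)

/-- Canonical coordinates `(X, T, U¹, …, Uᵐ)`, `m = n + 1`, for the generator `𝐗` of `G`: an
invertible smooth change of all variables with `𝐗X = 𝐗T = 0`, `𝐗U¹ = 1`, `𝐗Uⁱ = 0` for `i ≥ 2`.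
The range of the coordinates is taken such that `U¹` runs through an interval when
`X, T, U², …, Uᵐ` are held fixed. -/
structure CanonicalCoordinates {n : ℕ} (G : PointGroup (n + 1)) where
  Φ : OpenPartialHomeomorph (Base (n + 1)) (Base (n + 1))
  source_subset : Φ.source ⊆ G.M
  smooth : ContDiffOn ℝ ∞ Φ Φ.source
  smooth_symm : ContDiffOn ℝ ∞ Φ.symm Φ.target
  canonical : ∀ z ∈ Φ.source, fderiv ℝ Φ z (G.generator z) = eU n
  interval : ∀ w, OrdConnected {c : ℝ | w + c • eU n ∈ Φ.target}

/-- The change of variables `Φ` takes the smooth function `u` on `D` to the smooth function `U` on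
`D'`, i.e. it maps the graph of the one onto the graph of the other. -/
def Corresponds {k : ℕ} (Φ : OpenPartialHomeomorph (Base k) (Base k))
    (D : Set (ℝ × ℝ)) (u : ℝ × ℝ → Fin k → ℝ) (D' : Set (ℝ × ℝ)) (U : ℝ × ℝ → Fin k → ℝ) : Prop :=
  IsOpen D ∧ ContDiffOn ℝ ∞ u D ∧ IsOpen D' ∧ ContDiffOn ℝ ∞ U D' ∧
    graphOver D u ⊆ Φ.source ∧ Φ '' graphOver D u = graphOver D' U

/-- `U` with the constant `c` added to its first component `U¹`. -/
def shift {n : ℕ} (c : ℝ) (U : ℝ × ℝ → Fin (n + 1) → ℝ) : ℝ × ℝ → Fin (n + 1) → ℝ :=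
  fun p => U p + Pi.single 0 c

/-- The index of the undifferentiated variable. -/
def MIdx.zero (l : ℕ) : MIdx l := ⟨(0, 0), by simp⟩

/-- The system has the form `R̂^σ(X, T, Û, ∂U, …, ∂ˡU) = 0`: the variable `U¹` itself does not
occur in it (only its derivatives do). -/
def PDESystem.FreeOfU1 {n l s : ℕ} (S : PDESystem (n + 1) l s) : Prop :=
  ∀ (p : ℝ × ℝ) (w w' : Fin (n + 1) → MIdx l → ℝ),
    (∀ a μ, ¬ (a = 0 ∧ μ = MIdx.zero l) → w a μ = w' a μ) → (p, w) ∈ S.dom →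
    (p, w') ∈ S.dom ∧ S.R (p, w) = S.R (p, w')

/-- `S'` is the system `S` written in the new variables introduced by `Φ`:
corresponding functions solve `S` and `S'` simultaneously (where `S` is defined), and,
locally and up to a translation in `U¹` that brings it into the range of the coordinates, every
solution of `S'` arises from a solution of `S`. -/
structure InvertiblyEquivalent {n l s : ℕ} (S : PDESystem (n + 1) l s)
    (Φ : OpenPartialHomeomorph (Base (n + 1)) (Base (n + 1)))
    (S' : PDESystem (n + 1) l s) : Prop where
  iff : ∀ D u D' U, Corresponds Φ D u D' U → (∀ p ∈ D, jet l u p ∈ S.dom) →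
    (S.IsSolution D u ↔ S'.IsSolution D' U)
  lift : ∀ D' U, S'.IsSolution D' U → ∀ p ∈ D', ∃ D₀ ⊆ D', p ∈ D₀ ∧ ∃ (c : ℝ) (D : _) (u : _),
    Corresponds Φ D u D₀ (shift c U) ∧ S.IsSolution D u

/-! ### The inverse potential system -/

/-- `(i, j) ↦ (i - 1, j)` (used for `i ≥ 1`). -/
def MIdx.predX {l : ℕ} (μ : MIdx l) : MIdx l :=
  ⟨(⟨(μ.1.1 : ℕ) - 1, by omega⟩, μ.1.2), by have := μ.2; simp only; omega⟩

/-- `(i, j) ↦ (i, j - 1)` (used for `j ≥ 1`). -/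
def MIdx.predT {l : ℕ} (μ : MIdx l) : MIdx l :=
  ⟨(μ.1.1, ⟨(μ.1.2 : ℕ) - 1, by omega⟩), by have := μ.2; simp only; omega⟩

/-- The index of `∂_X`, for systems of order at least one. -/
def MIdx.oneX {l : ℕ} (hl : 1 ≤ l) : MIdx l := ⟨(⟨1, by omega⟩, 0), by simpa using hl⟩

/-- The index of `∂_T`, for systems of order at least one. -/
def MIdx.oneT {l : ℕ} (hl : 1 ≤ l) : MIdx l := ⟨(0, ⟨1, by omega⟩), by simpa using hl⟩

/-- The substitution of `α` for `U¹_T` and `β` for `U¹_X`. The dependent variables of the result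
are numbered `(α, β, U², …, Uᵐ)`. Derivatives of `U¹` containing both `∂_X` and `∂_T` can be
written through `β` or through `α`; `κ` says which is done. The variable `U¹` itself, which does
not occur in the systems to which this is applied, is replaced by `0`. -/
def substAlphaBeta {n l : ℕ} (κ : MIdx l → Bool) (j : Jet (n + 2) l) : Jet (n + 1) l :=
  (j.1, Fin.cons
    (fun μ : MIdx l =>
      if (μ.1.1 : ℕ) = 0 then
        (if (μ.1.2 : ℕ) = 0 then 0 else j.2 0 μ.predT)
      else if (μ.1.2 : ℕ) = 0 ∨ κ μ = true then j.2 1 μ.predX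
      else j.2 0 μ.predT)
    (fun i : Fin n => j.2 i.succ.succ))

theorem contDiff_substAlphaBeta {n l : ℕ} (κ : MIdx l → Bool) :
    ContDiff ℝ ∞ (substAlphaBeta (n := n) κ) := by
  unfold substAlphaBeta
  refine contDiff_fst.prodMk (contDiff_pi.2 fun a => contDiff_pi.2 fun μ => ?_)
  refine Fin.cases ?_ (fun i => ?_) a
  · simp only [Fin.cons_zero]
    split_ifs <;> fun_prop
  · simp only [Fin.cons_succ]
    fun_prop

/-- The inverse potential system of a system `R̂(X, T, Û, ∂U, …) = 0`: the equation
`α_X = β_T` together with the system `R̃ = 0` obtained by substituting `α = U¹_T`, `β = U¹_X`. -/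
def inversePotentialSystem {n l s : ℕ} (hl : 1 ≤ l) (κ : MIdx l → Bool)
    (S : PDESystem (n + 1) l s) : PDESystem (n + 2) l (s + 1) where
  dom := substAlphaBeta κ ⁻¹' S.dom
  isOpen_dom := S.isOpen_dom.preimage (contDiff_substAlphaBeta κ).continuous
  R := fun j => Fin.cons (j.2 0 (MIdx.oneX hl) - j.2 1 (MIdx.oneT hl)) (S.R (substAlphaBeta κ j))
  contDiffOn_R := by
    have h : ContDiffOn ℝ ∞ (fun j => S.R (substAlphaBeta κ j)) (substAlphaBeta κ ⁻¹' S.dom) :=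
      S.contDiffOn_R.comp (contDiff_substAlphaBeta (n := n) κ).contDiffOn (fun _ hx => hx)
    refine contDiffOn_pi.2 fun a => ?_
    refine Fin.cases ?_ (fun i => ?_) a
    · simp only [Fin.cons_zero]
      exact ContDiff.contDiffOn (by fun_prop)
    · simp only [Fin.cons_succ]
      exact contDiffOn_pi.1 h i

/-- The functions `(α, β, U², …, Uᵐ) = (U¹_T, U¹_X, U², …, Uᵐ)` obtained from
`U = (U¹, …, Uᵐ)`. -/
def dropU1 {n : ℕ} (U : ℝ × ℝ → Fin (n + 1) → ℝ) : ℝ × ℝ → Fin (n + 2) → ℝ := fun p =>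
  Fin.cons (pdT (fun q => U q 0) p) (Fin.cons (pdX (fun q => U q 0) p) (fun i => U p i.succ))

/-- `(g, U², …, Uᵐ)`, where `w = (α, β, U², …, Uᵐ)`. -/
def withU1 {n : ℕ} (g : ℝ × ℝ → ℝ) (w : ℝ × ℝ → Fin (n + 2) → ℝ) : ℝ × ℝ → Fin (n + 1) → ℝ :=
  fun p => Fin.cons (g p) (fun i => w p i.succ.succ)

/-- The connection between a function `u` of the original variables on `D` and functions
`w = (α, β, U², …, Uᵐ)` on `D'`: in the new variables `u` is some `U`, and
`w = (U¹_T, U¹_X, U², …, Uᵐ)`. -/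
def Linked {n : ℕ} (Φ : OpenPartialHomeomorph (Base (n + 1)) (Base (n + 1)))
    (D : Set (ℝ × ℝ)) (u : ℝ × ℝ → Fin (n + 1) → ℝ)
    (D' : Set (ℝ × ℝ)) (w : ℝ × ℝ → Fin (n + 2) → ℝ) : Prop :=
  ∃ U, Corresponds Φ D u D' U ∧ EqOn w (dropU1 U) D'

/-- The system `I` in the variables `(α, β, U², …, Uᵐ)` is nonlocally related to the system `S`,
and to its form `S'` in the variables `(X, T, U¹, …, Uᵐ)` introduced by `Φ`, with `U¹` as the
nonlocal variable. -/
structure NonlocallyRelated {n l s s' : ℕ} (S : PDESystem (n + 1) l s)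
    (Φ : OpenPartialHomeomorph (Base (n + 1)) (Base (n + 1)))
    (S' : PDESystem (n + 1) l s) (I : PDESystem (n + 2) l s') : Prop where
  /-- Every solution of `S` yields a solution of `I`. -/
  forward : ∀ D u D' w, S.IsSolution D u → Linked Φ D u D' w → I.IsSolution D' w
  /-- This applies locally to every solution of `S` at every point where its graph is
  transversal to the change of variables, so that `(X, T)` can serve as independent variables. -/
  forward_exists : ∀ D u, S.IsSolution D u → ∀ p ∈ D, (p, u p) ∈ Φ.source →
    Function.Bijective (fderiv ℝ (fun q => (Φ (q, u q)).1) p) →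
    ∃ D₁ ⊆ D, p ∈ D₁ ∧ ∃ D' w, Linked Φ D₁ u D' w ∧ I.IsSolution D' w
  /-- Every solution of `S'` yields a solution of `I`. -/
  project : ∀ D' U, S'.IsSolution D' U → I.IsSolution D' (dropU1 U)
  /-- On a simply connected domain, every solution of `I` comes from a family `U¹ = h + C`,
  `C` an arbitrary constant, of solutions of `S'`, and from no others. -/
  potential : ∀ D' w, IsSimplyConnected D' → I.IsSolution D' w →
    ∃ h : ℝ × ℝ → ℝ, ContDiffOn ℝ ∞ h D' ∧ ∀ g : ℝ × ℝ → ℝ,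
      (S'.IsSolution D' (withU1 g w) ∧ EqOn w (dropU1 (withU1 g w)) D') ↔
        ∃ C : ℝ, ∀ p ∈ D', g p = h p + C
  /-- Every solution of `I` locally yields solutions of `S`, in fact a one-parameter family of
  them whose members differ in an additive constant in `U¹`. -/
  backward : ∀ D' w, I.IsSolution D' w → ∀ p ∈ D', ∃ D₀ ⊆ D', p ∈ D₀ ∧
    ∃ (U : ℝ × ℝ → Fin (n + 1) → ℝ) (δ : ℝ), 0 < δ ∧ EqOn w (dropU1 U) D₀ ∧
      ∀ c : ℝ, |c| < δ → ∃ D u, S.IsSolution D u ∧ Corresponds Φ D u D₀ (shift c U) ∧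
        Linked Φ D u D₀ w
  /-- Two solutions of `S` yield the same solution of `I` exactly if they differ by an additive
  constant in `U¹`. -/
  same_image : ∀ D₁ u₁ D₂ u₂ D' U₁ U₂, IsPreconnected D' →
    S.IsSolution D₁ u₁ → S.IsSolution D₂ u₂ →
    Corresponds Φ D₁ u₁ D' U₁ → Corresponds Φ D₂ u₂ D' U₂ →
    (EqOn (dropU1 U₁) (dropU1 U₂) D' ↔ ∃ c : ℝ, EqOn U₂ (shift c U₁) D')
  /-- The correspondence is not one-to-one: near every point, every solution of `I` comes from
  different solutions of `S`. -/
  not_one_to_one : ∀ D' w, I.IsSolution D' w → ∀ p ∈ D', ∃ D₀ ⊆ D', p ∈ D₀ ∧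
    ∃ D₁ u₁ D₂ u₂, S.IsSolution D₁ u₁ ∧ S.IsSolution D₂ u₂ ∧
      Linked Φ D₁ u₁ D₀ w ∧ Linked Φ D₂ u₂ D₀ w ∧
      Disjoint (graphOver D₁ u₁) (graphOver D₂ u₂)
  /-- `U¹` is not a local function of `X`, `T`, the variables of `I` and their derivatives up to
  any finite order `k`: near any solution, no such expression is valid. -/
  not_local : ∀ (k : ℕ) (F : Jet (n + 2) k → ℝ) D u D' U, S.IsSolution D u →
    Corresponds Φ D u D' U → D'.Nonempty →
    ∃ D₀ ⊆ D', ∃ D₁ v V, S.IsSolution D₁ v ∧ Corresponds Φ D₁ v D₀ V ∧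
      (∃ c : ℝ, EqOn V (shift c U) D₀) ∧ ∃ p ∈ D₀, V p 0 ≠ F (jet k (dropU1 V) p)

end

/-!
Canonical coordinates come from straightening the generator: near a point where it does not
vanish, carrying a transversal hyperplane along the group gives, by the inverse function theorem,
coordinates in which the orbits are the `U¹`-lines. In any canonical coordinates the group acts by
translation of `U¹`, as long as the translated point stays in the range of the coordinates
(`CanonicalCoordinates.flow_eq`); the coordinate lines being intervals, this covers all
translations between points of the range. Hence functions that differ by a constant in `U¹` come
from functions of the original variables that solve the given system simultaneously
(`isSolution_of_corresponds_shift`).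

The change of variables prolongs to jets: the jet of `u` is a continuous function of the jet of the
corresponding `U` (`exists_prolongation`, by recursion on the order, with Cramer's rule at each
step), and at jets where `(x, t)` can serve as independent variables every `U`, together with its
translates by small constants, does locally come from some `u` (`exists_corresponds_family`).

For the system in canonical coordinates (`exists_invertiblyEquivalent`) it does not suffice to
transform the left-hand sides. Only the set of solutions is invariant; the zero set of `R^σ` may
contain jets that do not belong to any solution and whose translates are not zeros. The equation
`R̂^σ = 0` has to say that `R^σ` vanishes at *all* translates of the jet at which it is defined.
The jets that violate this form an open set, invariant under translation in `U¹`, and every open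
set is the set where some smooth function does not vanish.

A solution of the inverse potential system is the same as a solution of the transformed system
with `U¹` known only through its partial derivatives `β dX + α dT` (`isSolution_dropU1_iff`), since
`U¹` itself does not occur. The equation `α_X = β_T` says that this one-form is closed, so the
Poincaré lemma (`exists_potential`) recovers `U¹` up to a constant on simply connected domains.
There the lemma is obtained from the one for balls by lifting the identity to the covering space
whose points are the local primitives. Finally, `α`, `β` and `Û` are blind to the
constant in `U¹`, while all small constants are realized by solutions of the original system
over a common domain (`exists_solution_family`); this gives the family of preimages, disjoint
graphs, and the impossibility to express `U¹` locally.
-/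

/-! ### Calculus of partial derivatives and jets -/

theorem ContDiffOn.pdX {f : ℝ × ℝ → ℝ} {D : Set (ℝ × ℝ)} (hf : ContDiffOn ℝ ∞ f D)
    (hD : IsOpen D) : ContDiffOn ℝ ∞ (pdX f) D :=
  (hf.fderiv_of_isOpen hD (m := ∞) (by simp)).clm_apply contDiffOn_const

theorem ContDiffOn.pdT {f : ℝ × ℝ → ℝ} {D : Set (ℝ × ℝ)} (hf : ContDiffOn ℝ ∞ f D)
    (hD : IsOpen D) : ContDiffOn ℝ ∞ (pdT f) D :=
  (hf.fderiv_of_isOpen hD (m := ∞) (by simp)).clm_apply contDiffOn_const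

theorem ContDiffOn.iterate_pdX {f : ℝ × ℝ → ℝ} {D : Set (ℝ × ℝ)} (hf : ContDiffOn ℝ ∞ f D)
    (hD : IsOpen D) (i : ℕ) : ContDiffOn ℝ ∞ (_root_.pdX^[i] f) D := by
  induction i with
  | zero => exact hf
  | succ i ih => rw [Function.iterate_succ_apply']; exact ih.pdX hD

theorem ContDiffOn.iterate_pdT {f : ℝ × ℝ → ℝ} {D : Set (ℝ × ℝ)} (hf : ContDiffOn ℝ ∞ f D)
    (hD : IsOpen D) (i : ℕ) : ContDiffOn ℝ ∞ (_root_.pdT^[i] f) D := by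
  induction i with
  | zero => exact hf
  | succ i ih => rw [Function.iterate_succ_apply']; exact ih.pdT hD

theorem ContDiffOn.pd {f : ℝ × ℝ → ℝ} {D : Set (ℝ × ℝ)} (hf : ContDiffOn ℝ ∞ f D)
    (hD : IsOpen D) (i j : ℕ) : ContDiffOn ℝ ∞ (pd i j f) D :=
  (hf.iterate_pdT hD j).iterate_pdX hD i

theorem Set.EqOn.fderiv_eq_of_isOpen {f g : ℝ × ℝ → ℝ} {D : Set (ℝ × ℝ)} (h : EqOn f g D)
    (hD : IsOpen D) {p : ℝ × ℝ} (hp : p ∈ D) : fderiv ℝ f p = fderiv ℝ g p :=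
  Filter.EventuallyEq.fderiv_eq (h.eventuallyEq_of_mem (hD.mem_nhds hp))

theorem Set.EqOn.pdX {f g : ℝ × ℝ → ℝ} {D : Set (ℝ × ℝ)} (h : EqOn f g D) (hD : IsOpen D) :
    EqOn (pdX f) (pdX g) D := fun p hp => by
  simp only [_root_.pdX, h.fderiv_eq_of_isOpen hD hp]

theorem Set.EqOn.pdT {f g : ℝ × ℝ → ℝ} {D : Set (ℝ × ℝ)} (h : EqOn f g D) (hD : IsOpen D) :
    EqOn (pdT f) (pdT g) D := fun p hp => by
  simp only [_root_.pdT, h.fderiv_eq_of_isOpen hD hp]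

theorem Set.EqOn.iterate_pdX {f g : ℝ × ℝ → ℝ} {D : Set (ℝ × ℝ)} (h : EqOn f g D)
    (hD : IsOpen D) (i : ℕ) : EqOn (_root_.pdX^[i] f) (_root_.pdX^[i] g) D := by
  induction i with
  | zero => exact h
  | succ i ih => simp only [Function.iterate_succ_apply']; exact ih.pdX hD

theorem Set.EqOn.iterate_pdT {f g : ℝ × ℝ → ℝ} {D : Set (ℝ × ℝ)} (h : EqOn f g D)
    (hD : IsOpen D) (i : ℕ) : EqOn (_root_.pdT^[i] f) (_root_.pdT^[i] g) D := by
  induction i with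
  | zero => exact h
  | succ i ih => simp only [Function.iterate_succ_apply']; exact ih.pdT hD

theorem Set.EqOn.pd {f g : ℝ × ℝ → ℝ} {D : Set (ℝ × ℝ)} (h : EqOn f g D) (hD : IsOpen D)
    (i j : ℕ) : EqOn (pd i j f) (pd i j g) D :=
  (h.iterate_pdT hD j).iterate_pdX hD i

theorem pdX_pdT_comm {f : ℝ × ℝ → ℝ} {D : Set (ℝ × ℝ)} (hf : ContDiffOn ℝ ∞ f D)
    (hD : IsOpen D) : EqOn (pdX (pdT f)) (pdT (pdX f)) D := by
  intro p hp
  have hfp : ContDiffAt ℝ ∞ f p := hf.contDiffAt (hD.mem_nhds hp)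
  have hd : DifferentiableAt ℝ (fderiv ℝ f) p :=
    (hfp.fderiv_right (m := 1) (by norm_cast)).differentiableAt (by norm_num)
  have hs : IsSymmSndFDerivAt ℝ f p := hfp.isSymmSndFDerivAt (by simp; norm_cast)
  have h1 : ∀ v w : ℝ × ℝ, fderiv ℝ (fun q => fderiv ℝ f q v) p w
      = fderiv ℝ (fderiv ℝ f) p w v := by
    intro v w
    rw [fderiv_clm_apply hd (differentiableAt_const v)]
    simp
  change fderiv ℝ (fun q => fderiv ℝ f q (0, 1)) p (1, 0)
    = fderiv ℝ (fun q => fderiv ℝ f q (1, 0)) p (0, 1)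
  rw [h1, h1]
  exact hs _ _

theorem iterate_pdT_pdX_comm {f : ℝ × ℝ → ℝ} {D : Set (ℝ × ℝ)} (hf : ContDiffOn ℝ ∞ f D)
    (hD : IsOpen D) (j : ℕ) : EqOn (pdT^[j] (pdX f)) (pdX (pdT^[j] f)) D := by
  induction j with
  | zero => exact fun _ _ => rfl
  | succ j ih =>
    simp only [Function.iterate_succ_apply']
    exact (ih.pdT hD).trans (pdX_pdT_comm (hf.iterate_pdT hD j) hD).symm

theorem iterate_pdX_pdT_comm {f : ℝ × ℝ → ℝ} {D : Set (ℝ × ℝ)} (hf : ContDiffOn ℝ ∞ f D)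
    (hD : IsOpen D) (i : ℕ) : EqOn (pdX^[i] (pdT f)) (pdT (pdX^[i] f)) D := by
  induction i with
  | zero => exact fun _ _ => rfl
  | succ i ih =>
    simp only [Function.iterate_succ_apply']
    exact (ih.pdX hD).trans (pdX_pdT_comm (hf.iterate_pdX hD i) hD)

theorem pdX_pd (i j : ℕ) (f : ℝ × ℝ → ℝ) : pdX (pd i j f) = pd (i + 1) j f :=
  (Function.iterate_succ_apply' _ _ _).symm

theorem pdT_pd {f : ℝ × ℝ → ℝ} {D : Set (ℝ × ℝ)} (hf : ContDiffOn ℝ ∞ f D)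
    (hD : IsOpen D) (i j : ℕ) : EqOn (pdT (pd i j f)) (pd i (j + 1) f) D := by
  simp only [pd, Function.iterate_succ_apply' pdT j]
  exact (iterate_pdX_pdT_comm (hf.iterate_pdT hD j) hD i).symm

theorem pd_pdT (i j : ℕ) (f : ℝ × ℝ → ℝ) : pd i j (pdT f) = pd i (j + 1) f := rfl

theorem pd_pdX {f : ℝ × ℝ → ℝ} {D : Set (ℝ × ℝ)} (hf : ContDiffOn ℝ ∞ f D)
    (hD : IsOpen D) (i j : ℕ) : EqOn (pd i j (pdX f)) (pd (i + 1) j f) D := by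
  simp only [pd, Function.iterate_succ_apply]
  exact (iterate_pdT_pdX_comm hf hD j).iterate_pdX hD i

theorem pdX_add_const (f : ℝ × ℝ → ℝ) (c : ℝ) : pdX (fun q => f q + c) = pdX f := by
  funext p; simp [pdX]

theorem pdT_add_const (f : ℝ × ℝ → ℝ) (c : ℝ) : pdT (fun q => f q + c) = pdT f := by
  funext p; simp [pdT]

theorem pd_add_const (f : ℝ × ℝ → ℝ) (c : ℝ) (i j : ℕ) (h : i ≠ 0 ∨ j ≠ 0) :
    pd i j (fun q => f q + c) = pd i j f := by
  cases j with
  | zero =>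
    cases i with
    | zero => simp at h
    | succ i => simp only [pd, Function.iterate_zero, id, Function.iterate_succ_apply,
        pdX_add_const]
  | succ j => simp only [pd, Function.iterate_succ_apply, pdT_add_const]

/-- The derivative of a function of two variables in terms of its partial derivatives. -/
theorem fderiv_apply_eq_pd (f : ℝ × ℝ → ℝ) (p v : ℝ × ℝ) :
    fderiv ℝ f p v = v.1 * pdX f p + v.2 * pdT f p := by
  have : v = v.1 • ((1, 0) : ℝ × ℝ) + v.2 • ((0, 1) : ℝ × ℝ) := by ext <;> simp
  rw [congrArg (fderiv ℝ f p) this, map_add, map_smul, map_smul]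
  rfl

/-- On a connected open set a function is determined by its partial derivatives up to a
constant. -/
theorem exists_eq_add_const {f g : ℝ × ℝ → ℝ} {D : Set (ℝ × ℝ)} (hD : IsOpen D)
    (hc : IsPreconnected D) (hf : ContDiffOn ℝ ∞ f D) (hg : ContDiffOn ℝ ∞ g D)
    (hX : EqOn (pdX f) (pdX g) D) (hT : EqOn (pdT f) (pdT g) D) :
    ∃ c : ℝ, ∀ p ∈ D, g p = f p + c := by
  obtain ⟨a, ha⟩ := hD.exists_eq_add_of_fderiv_eq hc (hg.differentiableOn (by simp))
    (hf.differentiableOn (by simp)) (fun p hp => by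
      refine ContinuousLinearMap.ext fun v => ?_
      simp only [fderiv_apply_eq_pd, hX hp, hT hp])
  exact ⟨a, ha⟩

theorem contDiffOn_component {k : ℕ} {u : ℝ × ℝ → Fin k → ℝ} {D : Set (ℝ × ℝ)}
    (hu : ContDiffOn ℝ ∞ u D) (a : Fin k) : ContDiffOn ℝ ∞ (fun q => u q a) D :=
  contDiffOn_pi.1 hu a

theorem contDiffOn_jet {k : ℕ} {u : ℝ × ℝ → Fin k → ℝ} {D : Set (ℝ × ℝ)} (hD : IsOpen D)
    (hu : ContDiffOn ℝ ∞ u D) (l : ℕ) : ContDiffOn ℝ ∞ (jet l u) D :=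
  contDiffOn_id.prodMk (contDiffOn_pi.2 fun a => contDiffOn_pi.2 fun _ =>
    (contDiffOn_component hu a).pd hD _ _)

theorem jet_congr {k : ℕ} {u v : ℝ × ℝ → Fin k → ℝ} {D : Set (ℝ × ℝ)} (hD : IsOpen D)
    (h : EqOn u v D) (l : ℕ) {p : ℝ × ℝ} (hp : p ∈ D) : jet l u p = jet l v p := by
  refine Prod.ext rfl (funext fun a => funext fun μ => ?_)
  have h' : EqOn (fun q => u q a) (fun q => v q a) D := fun q hq => congrFun (h hq) a
  exact h'.pd hD _ _ hp

/-- The jet `J` with the constant `c` added to the value of `U¹`, its derivatives unchanged. -/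
def jetShift {n l : ℕ} (c : ℝ) (J : Jet (n + 1) l) : Jet (n + 1) l :=
  J + (0, Pi.single 0 (Pi.single (MIdx.zero l) c))

theorem jet_shift {n : ℕ} (l : ℕ) (c : ℝ) (U : ℝ × ℝ → Fin (n + 1) → ℝ) (p : ℝ × ℝ) :
    jet l (shift c U) p = jetShift c (jet l U p) := by
  refine Prod.ext (by simp [jetShift, jet]) (funext fun a => funext fun μ => ?_)
  simp only [jet, jetShift, shift, Prod.snd_add, Pi.add_apply]
  by_cases ha : a = 0
  · subst ha
    simp only [Pi.single_eq_same]
    by_cases hμ : μ = MIdx.zero l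
    · subst hμ
      simp [MIdx.zero, pd]
    · rw [Pi.single_eq_of_ne hμ, add_zero, pd_add_const]
      by_contra! h
      apply hμ
      ext <;> simp [MIdx.zero, h.1, h.2]
  · simp [Pi.single_eq_of_ne ha]

theorem continuous_jetShift {n l : ℕ} (c : ℝ) : Continuous (jetShift (n := n) (l := l) c) := by
  unfold jetShift; fun_prop

theorem jetShift_jetShift {n l : ℕ} (c d : ℝ) (J : Jet (n + 1) l) :
    jetShift c (jetShift d J) = jetShift (d + c) J := by
  simp only [jetShift, add_assoc]
  congr 1
  simp [← Pi.single_add]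

@[simp] theorem jetShift_zero {n l : ℕ} (J : Jet (n + 1) l) : jetShift 0 J = J := by
  simp [jetShift]

theorem shift_apply_zero {n : ℕ} (c : ℝ) (U : ℝ × ℝ → Fin (n + 1) → ℝ) (p : ℝ × ℝ) :
    shift c U p 0 = U p 0 + c := by simp [shift]

theorem shift_apply_succ {n : ℕ} (c : ℝ) (U : ℝ × ℝ → Fin (n + 1) → ℝ) (p : ℝ × ℝ) (i : Fin n) :
    shift c U p i.succ = U p i.succ := by simp [shift]

@[simp] theorem shift_zero {n : ℕ} (U : ℝ × ℝ → Fin (n + 1) → ℝ) : shift 0 U = U := by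
  funext p; simp [shift]

theorem contDiffOn_shift {n : ℕ} {U : ℝ × ℝ → Fin (n + 1) → ℝ} {D : Set (ℝ × ℝ)}
    (hU : ContDiffOn ℝ ∞ U D) (c : ℝ) : ContDiffOn ℝ ∞ (shift c U) D :=
  hU.add contDiffOn_const

theorem dropU1_shift {n : ℕ} (c : ℝ) (U : ℝ × ℝ → Fin (n + 1) → ℝ) :
    dropU1 (shift c U) = dropU1 U := by
  funext p
  simp only [dropU1, shift_apply_zero, shift_apply_succ, pdX_add_const, pdT_add_const]

/-! ### The Poincaré lemma on simply connected plane domains -/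

/-- The real line with the discrete topology. -/
def DiscreteReal : Type := ℝ

instance : TopologicalSpace DiscreteReal := ⊥

instance : DiscreteTopology DiscreteReal := ⟨rfl⟩

instance : AddCommGroup DiscreteReal := inferInstanceAs (AddCommGroup ℝ)

/-- The bundle of primitives, for an open cover `B` of a space with local primitives `h` that
differ by locally constant functions: over `B i` the element `c` of the fibre stands for the
primitive `h i + c`. -/
noncomputable def primitiveBundle {X : Type*} [TopologicalSpace X] (B : X → Set X)
    (hB : ∀ i, IsOpen (B i)) (hmem : ∀ x, x ∈ B x) (h : X → X → DiscreteReal)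
    (hc : ∀ i j, ContinuousOn (fun x => h i x - h j x) (B i ∩ B j)) :
    FiberBundleCore X X DiscreteReal where
  baseSet := B
  isOpen_baseSet := hB
  indexAt := id
  mem_baseSet_at := hmem
  coordChange i j x c := c + (h i x - h j x)
  coordChange_self i x _ v := by simp
  continuousOn_coordChange i j :=
    continuous_of_discreteTopology.comp_continuousOn
      (f := fun p : X × DiscreteReal => (p.2, h i p.1 - h j p.1))
      (g := fun q : DiscreteReal × DiscreteReal => q.1 + q.2)
      (continuousOn_snd.prodMk ((hc i j).comp continuousOn_fst (fun _ hp => hp.1)))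
  coordChange_comp i j k x _ v := by abel

/-- Local primitives that differ by locally constant functions glue to a global one on a simply
connected space: the bundle of primitives is a covering, so it has a section. -/
theorem exists_global_primitive {X : Type*} [TopologicalSpace X] [SimplyConnectedSpace X]
    [LocallyPathConnectedSpace X] (B : X → Set X)
    (hB : ∀ i, IsOpen (B i)) (hmem : ∀ x, x ∈ B x) (h : X → X → ℝ)
    (hc : ∀ i j, ∀ x ∈ B i ∩ B j, ∀ᶠ y in nhds x, h i y - h j y = h i x - h j x) :
    ∃ H : X → ℝ, ∀ x, ∀ᶠ y in nhds x, H y - h x y = H x - h x x := by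
  let h' : X → X → DiscreteReal := h
  have hc' : ∀ i j, ContinuousOn (fun x => h' i x - h' j x) (B i ∩ B j) := fun i j x hx =>
    ((continuousAt_const (y := h' i x - h' j x)).congr
      ((hc i j x hx).mono fun _ hy => hy.symm)).continuousWithinAt
  let Z := primitiveBundle B hB hmem h' hc'
  have cov : IsCoveringMap (Bundle.TotalSpace.proj : Z.TotalSpace → X) :=
    FiberBundle.isCoveringMap
  obtain ⟨x₀⟩ : Nonempty X := inferInstance
  obtain ⟨F, ⟨-, hF⟩, -⟩ := cov.existsUnique_continuousMap_lifts (ContinuousMap.id X) x₀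
    (⟨x₀, (0 : DiscreteReal)⟩ : Z.TotalSpace) rfl
  have hFp : ∀ x, (F x).proj = x := fun x => congrFun hF x
  let f : X → DiscreteReal := fun x => (F x).2
  let H : X → DiscreteReal := fun x => f x + h' x x
  have h1 : ∀ i, ContinuousOn (fun x => H x - h' i x) (B i) := by
    intro i
    have h2 : ContinuousOn (fun x => (Z.localTriv i (F x)).2) (B i) := by
      refine continuousOn_snd.comp ((Z.localTriv i).continuousOn.comp F.continuous.continuousOn
        (fun x hx => ?_)) (mapsTo_univ _ _)
      rw [Z.mem_localTriv_source, hFp]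
      exact hx
    refine h2.congr fun x _ => ?_
    beta_reduce
    rw [Z.localTriv_apply]
    change f x + h' x x - h' i x = f x + (h' (F x).proj (F x).proj - h' i (F x).proj)
    rw [hFp, add_sub_assoc]
  refine ⟨H, fun x => ?_⟩
  exact ((h1 x).continuousAt ((hB x).mem_nhds (hmem x))).eventually
    (p := fun z => z = H x - h' x x) ((isOpen_discrete _).mem_nhds rfl)

/-- The one-form `β dX + α dT`. -/
noncomputable def oneForm (α β : ℝ × ℝ → ℝ) (p : ℝ × ℝ) : ℝ × ℝ →L[ℝ] ℝ :=
  β p • ContinuousLinearMap.fst ℝ ℝ ℝ + α p • ContinuousLinearMap.snd ℝ ℝ ℝ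

theorem exists_hasFDerivAt_oneForm_of_convex {D : Set (ℝ × ℝ)} (hD : IsOpen D) (hs : Convex ℝ D)
    {α β : ℝ × ℝ → ℝ} (hα : ContDiffOn ℝ ∞ α D) (hβ : ContDiffOn ℝ ∞ β D)
    (hclosed : EqOn (pdX α) (pdT β) D) :
    ∃ h : ℝ × ℝ → ℝ, ∀ p ∈ D, HasFDerivAt h (oneForm α β p) p := by
  have hα' : ∀ p ∈ D, DifferentiableAt ℝ α p := fun p hp =>
    (hα.contDiffAt (hD.mem_nhds hp)).differentiableAt (by simp)
  have hβ' : ∀ p ∈ D, DifferentiableAt ℝ β p := fun p hp =>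
    (hβ.contDiffAt (hD.mem_nhds hp)).differentiableAt (by simp)
  have hd : ∀ p ∈ D, HasFDerivAt (oneForm α β)
      ((fderiv ℝ β p).smulRight (ContinuousLinearMap.fst ℝ ℝ ℝ)
        + (fderiv ℝ α p).smulRight (ContinuousLinearMap.snd ℝ ℝ ℝ)) p := fun p hp =>
    ((hβ' p hp).hasFDerivAt.smul_const (ContinuousLinearMap.fst ℝ ℝ ℝ)).add
      ((hα' p hp).hasFDerivAt.smul_const (ContinuousLinearMap.snd ℝ ℝ ℝ))
  refine hs.exists_forall_hasFDerivAt_of_fderiv_symmetric hD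
    (fun p hp => (hd p hp).differentiableAt.differentiableWithinAt) fun p hp v w => ?_
  rw [(hd p hp).fderiv]
  simp only [add_apply, ContinuousLinearMap.smulRight_apply,
    smul_apply, ContinuousLinearMap.coe_fst', ContinuousLinearMap.coe_snd',
    smul_eq_mul, fderiv_apply_eq_pd, hclosed hp]
  ring

theorem exists_hasFDerivAt_oneForm {D : Set (ℝ × ℝ)} (hD : IsOpen D) (hs : IsSimplyConnected D)
    {α β : ℝ × ℝ → ℝ} (hα : ContDiffOn ℝ ∞ α D) (hβ : ContDiffOn ℝ ∞ β D)
    (hclosed : EqOn (pdX α) (pdT β) D) :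
    ∃ h : ℝ × ℝ → ℝ, ∀ p ∈ D, HasFDerivAt h (oneForm α β p) p := by
  have := hs.simplyConnectedSpace
  have := hD.locallyPathConnectedSpace
  have hloc : ∀ x : D, ∃ r > 0, Metric.ball (x : ℝ × ℝ) r ⊆ D ∧
      ∃ h : ℝ × ℝ → ℝ, ∀ p ∈ Metric.ball (x : ℝ × ℝ) r, HasFDerivAt h (oneForm α β p) p := by
    intro x
    obtain ⟨r, hr, hrD⟩ := Metric.isOpen_iff.1 hD x x.2
    exact ⟨r, hr, hrD, exists_hasFDerivAt_oneForm_of_convex Metric.isOpen_ball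
      (convex_ball _ _) (hα.mono hrD) (hβ.mono hrD) (hclosed.mono hrD)⟩
  choose r hr hrD h hh using hloc
  obtain ⟨H, hH⟩ := exists_global_primitive (X := D)
    (fun x => Subtype.val ⁻¹' Metric.ball (x : ℝ × ℝ) (r x))
    (fun x => Metric.isOpen_ball.preimage continuous_subtype_val)
    (fun x => Metric.mem_ball_self (hr x)) (fun x y => h x y) (fun i j x hx => by
      have hconv : Convex ℝ (Metric.ball (i : ℝ × ℝ) (r i) ∩ Metric.ball (j : ℝ × ℝ) (r j)) :=
        (convex_ball _ _).inter (convex_ball _ _)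
      have ho : IsOpen (Metric.ball (i : ℝ × ℝ) (r i) ∩ Metric.ball (j : ℝ × ℝ) (r j)) :=
        Metric.isOpen_ball.inter Metric.isOpen_ball
      obtain ⟨c, hc⟩ := ho.exists_eq_add_of_fderiv_eq (𝕜 := ℝ) hconv.isPreconnected
        (fun p hp => (hh i p hp.1).differentiableAt.differentiableWithinAt)
        (fun p hp => (hh j p hp.2).differentiableAt.differentiableWithinAt)
        (fun p hp => by rw [(hh i p hp.1).fderiv, (hh j p hp.2).fderiv])
      filter_upwards [(ho.preimage continuous_subtype_val).mem_nhds hx] with y hy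
      rw [hc hy, hc hx]
      ring)
  classical
  refine ⟨fun p => if hp : p ∈ D then H ⟨p, hp⟩ else 0, fun p hp => ?_⟩
  let x : D := ⟨p, hp⟩
  have h1 := hH x
  have h3 : ∀ᶠ q in nhds p, ∃ hq : q ∈ D, (H ⟨q, hq⟩ - h x q : ℝ) = H x - h x p := by
    have := hD.isOpenEmbedding_subtypeVal.map_nhds_eq x
    rw [show p = (x : ℝ × ℝ) from rfl, ← this, Filter.eventually_map]
    filter_upwards [h1] with y hy
    exact ⟨y.2, hy⟩
  refine ((hh x p (Metric.mem_ball_self (hr x))).add_const ((H x : ℝ) - h x p)).congr_of_eventuallyEq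
    ?_
  filter_upwards [h3] with q hq
  obtain ⟨hq, hq'⟩ := hq
  rw [dif_pos hq, ← hq']
  ring

/-- A closed one-form `β dX + α dT` on a simply connected open set has a potential. -/
theorem exists_potential {D : Set (ℝ × ℝ)} (hD : IsOpen D) (hs : IsSimplyConnected D)
    {α β : ℝ × ℝ → ℝ} (hα : ContDiffOn ℝ ∞ α D) (hβ : ContDiffOn ℝ ∞ β D)
    (hclosed : EqOn (pdX α) (pdT β) D) :
    ∃ h : ℝ × ℝ → ℝ, ContDiffOn ℝ ∞ h D ∧ EqOn (pdX h) β D ∧ EqOn (pdT h) α D := by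
  obtain ⟨h, hh⟩ := exists_hasFDerivAt_oneForm hD hs hα hβ hclosed
  refine ⟨h, ?_, fun p hp => ?_, fun p hp => ?_⟩
  · rw [contDiffOn_infty_iff_fderiv_of_isOpen hD]
    refine ⟨fun p hp => (hh p hp).differentiableAt.differentiableWithinAt,
      ContDiffOn.congr (f := oneForm α β) ?_ fun p hp => (hh p hp).fderiv⟩
    exact (hβ.smul contDiffOn_const).add (hα.smul contDiffOn_const)
  · simp [pdX, (hh p hp).fderiv, oneForm]
  · simp [pdT, (hh p hp).fderiv, oneForm]

/-! ### The flow in canonical coordinates -/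

theorem PointGroup.contDiffAt {k : ℕ} (G : PointGroup k) {s : ℝ} {z : Base k}
    (h : (s, z) ∈ G.flowDom) :
    ContDiffAt ℝ ∞ (fun w : ℝ × Base k => G.φ w.1 w.2) (s, z) :=
  G.smooth.contDiffAt (G.isOpen_flowDom.mem_nhds h)

/-- The orbits of the group are integral curves of the infinitesimal generator. -/
theorem PointGroup.hasDerivAt_flow {k : ℕ} (G : PointGroup k) {s : ℝ} {z : Base k}
    (h : (s, z) ∈ G.flowDom) :
    HasDerivAt (fun ε => G.φ ε z) (G.generator (G.φ s z)) s := by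
  have hd : ∀ {s z}, (s, z) ∈ G.flowDom → DifferentiableAt ℝ (fun ε => G.φ ε z) s := by
    intro s z h
    exact ((G.contDiffAt h).differentiableAt (by simp)).comp (f := fun ε : ℝ => (ε, z)) s
      (by fun_prop)
  set y := G.φ s z with hy
  have hy0 : ((0 : ℝ), y) ∈ G.flowDom := G.zero_mem y (G.maps h)
  have hev : (fun ε => G.φ ε y) =ᶠ[nhds 0] fun ε => G.φ (ε + s) z := by
    have hcont : ContinuousAt (fun ε : ℝ => (ε, y)) 0 := by fun_prop
    filter_upwards [hcont.preimage_mem_nhds (G.isOpen_flowDom.mem_nhds hy0)] with ε hε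
    exact (G.map_mul h hε).symm
  have h1 : G.generator y = deriv (fun ε => G.φ ε z) s := by
    rw [PointGroup.generator, hev.deriv_eq, deriv_comp_add_const (f := fun ε => G.φ ε z)]
    simp
  rw [h1]
  exact (hd h).hasDerivAt

/-- Along an orbit, `U¹` grows at unit rate and the other coordinates are constant. -/
theorem CanonicalCoordinates.exists_flow_eq_local {n : ℕ} {G : PointGroup (n + 1)}
    (K : CanonicalCoordinates G) {y : Base (n + 1)} (hy : y ∈ K.Φ.source) :
    ∃ N ∈ nhds y, ∃ η > 0, ∀ y' ∈ N, ∀ s : ℝ, |s| < η →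
      (s, y') ∈ G.flowDom ∧ G.φ s y' ∈ K.Φ.source ∧ K.Φ (G.φ s y') = K.Φ y' + s • eU n := by
  have h0 : ((0 : ℝ), y) ∈ G.flowDom := G.zero_mem y (K.source_subset hy)
  have hev : ∀ᶠ w : ℝ × Base (n + 1) in nhds (0, y),
      w ∈ G.flowDom ∧ G.φ w.1 w.2 ∈ K.Φ.source := by
    refine Filter.Eventually.and (G.isOpen_flowDom.mem_nhds h0) ?_
    refine (G.contDiffAt h0).continuousAt.preimage_mem_nhds (K.Φ.open_source.mem_nhds ?_)
    rwa [G.map_zero y (K.source_subset hy)]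
  rw [nhds_prod_eq, Filter.eventually_prod_iff] at hev
  obtain ⟨p, hp, q, hq, hpq⟩ := hev
  obtain ⟨η, hη, hball⟩ := Metric.mem_nhds_iff.1 hp
  refine ⟨_, hq, η, hη, fun y' hy' s hs => ?_⟩
  have hmem : ∀ s ∈ Metric.ball (0 : ℝ) η, (s, y') ∈ G.flowDom ∧ G.φ s y' ∈ K.Φ.source :=
    fun s hs => hpq (hball hs) hy'
  have hder : ∀ s ∈ Metric.ball (0 : ℝ) η,
      HasDerivAt (fun s => K.Φ (G.φ s y') - s • eU n) 0 s := by
    intro s hs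
    obtain ⟨h1, h2⟩ := hmem s hs
    have hΦ : HasFDerivAt K.Φ (fderiv ℝ K.Φ (G.φ s y')) (G.φ s y') :=
      ((K.smooth.contDiffAt (K.Φ.open_source.mem_nhds h2)).differentiableAt
        (by simp)).hasFDerivAt
    have h3 := hΦ.comp_hasDerivAt s (G.hasDerivAt_flow h1)
    rw [K.canonical _ h2] at h3
    have h4 := h3.sub ((hasDerivAt_id s).smul_const (eU n))
    simpa using! h4
  have hs' : s ∈ Metric.ball (0 : ℝ) η := by simpa using hs
  refine ⟨(hmem s hs').1, (hmem s hs').2, ?_⟩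
  have h0' : (0 : ℝ) ∈ Metric.ball (0 : ℝ) η := Metric.mem_ball_self hη
  have hconst := Metric.isOpen_ball.is_const_of_deriv_eq_zero (convex_ball (0 : ℝ) η).isPreconnected
    (fun x hx => (hder x hx).differentiableAt.differentiableWithinAt)
    (fun x hx => (hder x hx).deriv) hs' h0'
  have hM : y' ∈ G.M := G.mem_of_flowDom (hmem 0 h0').1
  simp only [G.map_zero y' hM, zero_smul, sub_zero] at hconst
  rw [← hconst]
  simp

/-- In canonical coordinates the group acts by translations of `U¹`, as far as the range of the
coordinates allows. In particular the group parameter may be taken that large: the domain of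
the flow contains the whole part of the orbit that lies in the coordinate patch. -/
theorem CanonicalCoordinates.flow_eq {n : ℕ} {G : PointGroup (n + 1)}
    (K : CanonicalCoordinates G) {w : Base (n + 1)} (hw : w ∈ K.Φ.target) {c : ℝ}
    (hc : w + c • eU n ∈ K.Φ.target) :
    (c, K.Φ.symm w) ∈ G.flowDom ∧ G.φ c (K.Φ.symm w) = K.Φ.symm (w + c • eU n) := by
  set z := K.Φ.symm w with hz
  set I : Set ℝ := {s : ℝ | w + s • eU n ∈ K.Φ.target} with hI
  set A : Set ℝ := {s : ℝ | (s, z) ∈ G.flowDom ∧ G.φ s z = K.Φ.symm (w + s • eU n)} with hA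
  have hline : Continuous fun s : ℝ => w + s • eU n := by fun_prop
  have hIo : IsOpen I := K.Φ.open_target.preimage hline
  have hIc : IsPreconnected I := (K.interval w).isPreconnected
  -- Membership in `A` is locally constant on `I`.
  have hloc : ∀ s₀ ∈ I, ∀ᶠ s in nhds s₀, ∀ᶠ t in nhds s₀, s ∈ A → t ∈ A := by
    intro s₀ hs₀
    obtain ⟨N, hN, η, hη, hflow⟩ := K.exists_flow_eq_local (K.Φ.map_target hs₀)
    have hcont : ContinuousAt (fun s : ℝ => K.Φ.symm (w + s • eU n)) s₀ :=
      ContinuousAt.comp (f := fun s : ℝ => w + s • eU n) (K.Φ.continuousAt_symm hs₀)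
        hline.continuousAt
    have hball : ∀ᶠ s in nhds s₀, |s - s₀| < η / 2 := by
      filter_upwards [Metric.ball_mem_nhds s₀ (half_pos hη)] with s hs
      simpa [Real.dist_eq] using hs
    filter_upwards [hcont.preimage_mem_nhds hN, hball, hIo.mem_nhds hs₀] with s hsN hsη hsI
    filter_upwards [hball, hIo.mem_nhds hs₀] with t htη htI hsA
    have hts : |t - s| < η := by
      rw [abs_lt] at hsη htη ⊢
      constructor <;> linarith
    obtain ⟨h1, h2, h3⟩ := hflow (K.Φ.symm (w + s • eU n)) hsN (t - s) hts
    rw [← hsA.2] at h1 h2 h3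
    have h4 := G.map_mul hsA.1 h1
    have h5 := G.mul_mem hsA.1 h1
    rw [sub_add_cancel] at h4 h5
    refine ⟨h5, ?_⟩
    have h6 : w + t • eU n = K.Φ (G.φ t z) := by
      rw [h4, h3, hsA.2, K.Φ.right_inv hsI, add_assoc, ← add_smul]
      congr 2
      ring
    rw [h6, h4, K.Φ.left_inv h2]
  have h0A : (0 : ℝ) ∈ A := by
    have hzM : z ∈ G.M := K.source_subset (K.Φ.map_target hw)
    refine ⟨G.zero_mem z hzM, ?_⟩
    rw [G.map_zero z hzM, zero_smul, add_zero]
  have h0I : (0 : ℝ) ∈ I := by simpa [hI] using hw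
  have hAI : ∀ s₀ ∈ I, s₀ ∈ A → A ∈ nhds s₀ := fun s₀ hs₀ h =>
    ((hloc s₀ hs₀).self_of_nhds).mono fun t ht => ht h
  have hAIc : ∀ s₀ ∈ I, s₀ ∉ A → Aᶜ ∈ nhds s₀ := fun s₀ hs₀ h =>
    (hloc s₀ hs₀).mono fun s hs hsA => h (hs.self_of_nhds hsA)
  have hsub : I ⊆ interior A := by
    refine hIc.subset_left_of_subset_union isOpen_interior (v := interior Aᶜ) isOpen_interior
      ?_ (fun s hs => ?_) ⟨0, h0I, mem_interior_iff_mem_nhds.2 (hAI 0 h0I h0A)⟩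
    · exact disjoint_compl_right.mono interior_subset interior_subset
    · by_cases h : s ∈ A
      · exact Or.inl (mem_interior_iff_mem_nhds.2 (hAI s hs h))
      · exact Or.inr (mem_interior_iff_mem_nhds.2 (hAIc s hs h))
  have hcA : c ∈ A := interior_subset (hsub hc)
  exact hcA

/-! ### Corresponding functions -/

theorem Corresponds.symm {k : ℕ} {Φ : OpenPartialHomeomorph (Base k) (Base k)}
    {D D' : Set (ℝ × ℝ)} {u U : ℝ × ℝ → Fin k → ℝ} (h : Corresponds Φ D u D' U) :
    Corresponds Φ.symm D' U D u := by
  obtain ⟨hD, hu, hD', hU, hs, himg⟩ := h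
  have himg' : Φ.symm '' graphOver D' U = graphOver D u := by
    rw [← himg, ← image_comp]
    refine (image_congr fun z hz => ?_).trans (image_id _)
    exact Φ.left_inv (hs hz)
  refine ⟨hD', hU, hD, hu, ?_, himg'⟩
  rw [← himg]
  rintro _ ⟨z, hz, rfl⟩
  exact Φ.map_source (hs hz)

theorem Corresponds.mem_target {k : ℕ} {Φ : OpenPartialHomeomorph (Base k) (Base k)}
    {D D' : Set (ℝ × ℝ)} {u U : ℝ × ℝ → Fin k → ℝ} (h : Corresponds Φ D u D' U) {q : ℝ × ℝ}
    (hq : q ∈ D') : (q, U q) ∈ Φ.target :=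
  h.symm.2.2.2.2.1 ⟨q, hq, rfl⟩

/-- The old independent variables `(x, t)` of the point `(q, U q)` of the graph of a function `U`
of the new variables, `Φ` being the change from the old variables to the new. -/
noncomputable def baseMap {k : ℕ} (Φ : OpenPartialHomeomorph (Base k) (Base k))
    (U : ℝ × ℝ → Fin k → ℝ) (q : ℝ × ℝ) : ℝ × ℝ :=
  (Φ.symm (q, U q)).1

theorem Corresponds.baseMap_mem {k : ℕ} {Φ : OpenPartialHomeomorph (Base k) (Base k)}
    {D D' : Set (ℝ × ℝ)} {u U : ℝ × ℝ → Fin k → ℝ} (h : Corresponds Φ D u D' U) {q : ℝ × ℝ}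
    (hq : q ∈ D') : baseMap Φ U q ∈ D ∧ Φ.symm (q, U q) = (baseMap Φ U q, u (baseMap Φ U q)) := by
  have h1 : Φ.symm (q, U q) ∈ graphOver D u := by
    rw [← h.symm.2.2.2.2.2]
    exact ⟨_, ⟨q, hq, rfl⟩, rfl⟩
  obtain ⟨p, hp, hpe⟩ := h1
  have h2 : baseMap Φ U q = p := by simp [baseMap, ← hpe]
  rw [h2]
  exact ⟨hp, hpe.symm⟩

theorem Corresponds.baseMap_baseMap {k : ℕ} {Φ : OpenPartialHomeomorph (Base k) (Base k)}
    {D D' : Set (ℝ × ℝ)} {u U : ℝ × ℝ → Fin k → ℝ} (h : Corresponds Φ D u D' U) {q : ℝ × ℝ}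
    (hq : q ∈ D') : baseMap Φ.symm u (baseMap Φ U q) = q := by
  have h1 := (h.baseMap_mem hq).2
  rw [baseMap, ← h1, OpenPartialHomeomorph.symm_symm, Φ.right_inv (h.mem_target hq)]

theorem Corresponds.exists_baseMap_eq {k : ℕ} {Φ : OpenPartialHomeomorph (Base k) (Base k)}
    {D D' : Set (ℝ × ℝ)} {u U : ℝ × ℝ → Fin k → ℝ} (h : Corresponds Φ D u D' U) {p : ℝ × ℝ}
    (hp : p ∈ D) : ∃ q ∈ D', baseMap Φ U q = p := by
  refine ⟨baseMap Φ.symm u p, (h.symm.baseMap_mem hp).1, ?_⟩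
  have := h.symm.baseMap_baseMap hp
  rwa [OpenPartialHomeomorph.symm_symm] at this

theorem contDiffOn_baseMap {k : ℕ} {Φ : OpenPartialHomeomorph (Base k) (Base k)}
    (hΦ : ContDiffOn ℝ ∞ Φ.symm Φ.target) {D' : Set (ℝ × ℝ)} {U : ℝ × ℝ → Fin k → ℝ}
    (hU : ContDiffOn ℝ ∞ U D') (ht : ∀ q ∈ D', (q, U q) ∈ Φ.target) :
    ContDiffOn ℝ ∞ (baseMap Φ U) D' :=
  contDiff_fst.comp_contDiffOn (hΦ.comp (contDiffOn_id.prodMk hU) ht)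

/-- The correspondence can be restricted to an open part of the new domain. -/
theorem Corresponds.mono {k : ℕ} {Φ : OpenPartialHomeomorph (Base k) (Base k)}
    {D D' : Set (ℝ × ℝ)} {u U : ℝ × ℝ → Fin k → ℝ} (h : Corresponds Φ D u D' U)
    (hΦ : ContDiffOn ℝ ∞ Φ Φ.source) {D₀ : Set (ℝ × ℝ)} (hD₀ : IsOpen D₀) (hsub : D₀ ⊆ D') :
    Corresponds Φ (baseMap Φ U '' D₀) u D₀ U ∧ baseMap Φ U '' D₀ ⊆ D := by
  have himg : baseMap Φ U '' D₀ = D ∩ baseMap Φ.symm u ⁻¹' D₀ := by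
    ext p
    constructor
    · rintro ⟨q, hq, rfl⟩
      refine ⟨(h.baseMap_mem (hsub hq)).1, ?_⟩
      rwa [mem_preimage, h.baseMap_baseMap (hsub hq)]
    · rintro ⟨hp, hq⟩
      obtain ⟨q, hq', rfl⟩ := h.exists_baseMap_eq hp
      rw [mem_preimage, h.baseMap_baseMap hq'] at hq
      exact ⟨q, hq, rfl⟩
  have hsubD : baseMap Φ U '' D₀ ⊆ D := himg ▸ inter_subset_left
  refine ⟨⟨?_, h.2.1.mono hsubD, hD₀, h.2.2.2.1.mono hsub, ?_, ?_⟩, hsubD⟩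
  · rw [himg]
    exact (contDiffOn_baseMap (Φ := Φ.symm) (by simpa using hΦ) h.2.1
      (fun p hp => h.symm.mem_target hp)).continuousOn.isOpen_inter_preimage h.1 hD₀
  · exact (image_mono hsubD).trans h.2.2.2.2.1
  · ext z
    constructor
    · rintro ⟨_, ⟨_, ⟨q, hq, rfl⟩, rfl⟩, rfl⟩
      refine ⟨q, hq, ?_⟩
      beta_reduce
      rw [← (h.baseMap_mem (hsub hq)).2, Φ.right_inv (h.mem_target (hsub hq))]
    · rintro ⟨q, hq, rfl⟩
      refine ⟨_, ⟨_, ⟨q, hq, rfl⟩, rfl⟩, ?_⟩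
      beta_reduce
      rw [← (h.baseMap_mem (hsub hq)).2, Φ.right_inv (h.mem_target (hsub hq))]

/-- If a solution `u` and a function `v` become `U` and `U` shifted by a constant in canonical
coordinates, a group element carries the one to the other, so that `v` is a solution, too. -/
theorem isSolution_of_corresponds_shift {n l s : ℕ} {S : PDESystem (n + 1) l s}
    {G : PointGroup (n + 1)} (hG : IsPointSymmetry G S) (K : CanonicalCoordinates G)
    {D D₁ D' : Set (ℝ × ℝ)} {u v U : ℝ × ℝ → Fin (n + 1) → ℝ} {c : ℝ}
    (hu : S.IsSolution D u) (h : Corresponds K.Φ D u D' U)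
    (hv : Corresponds K.Φ D₁ v D' (shift c U)) (hdom : ∀ p ∈ D₁, jet l v p ∈ S.dom) :
    S.IsSolution D₁ v := by
  have hadd : ∀ q, (q, shift c U q) = (q, U q) + c • eU n := by
    intro q
    refine Prod.ext (by simp [eU]) ?_
    simp [shift, eU, ← Pi.single_smul]
  have hflow : ∀ q ∈ D', (c, K.Φ.symm (q, U q)) ∈ G.flowDom ∧
      G.φ c (K.Φ.symm (q, U q)) = K.Φ.symm (q, shift c U q) := by
    intro q hq
    have h2 := hv.mem_target hq
    rw [hadd] at h2 ⊢
    exact K.flow_eq (h.mem_target hq) h2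
  refine hG c D D₁ u v hu hv.1 hv.2.1 ?_ ?_ hdom
  · rw [← h.symm.2.2.2.2.2]
    rintro _ ⟨_, ⟨q, hq, rfl⟩, rfl⟩
    exact (hflow q hq).1
  · rw [← h.symm.2.2.2.2.2, ← hv.symm.2.2.2.2.2]
    simp only [graphOver, image_image]
    exact image_congr fun q hq => (hflow q hq).2

/-! ### Existence of canonical coordinates -/

/-- The inverse function theorem for smooth maps, with an inverse that is smooth on its whole
domain. -/
theorem exists_smooth_local_inverse {E : Type*} [NormedAddCommGroup E] [NormedSpace ℝ E]
    [CompleteSpace E] {f : E → E} {U : Set E} (hU : IsOpen U) (hf : ContDiffOn ℝ ∞ f U) {a : E}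
    (ha : a ∈ U) (L : E ≃L[ℝ] E) (hL : HasFDerivAt f (L : E →L[ℝ] E) a) :
    ∃ e : OpenPartialHomeomorph E E, a ∈ e.source ∧ e.source ⊆ U ∧ (∀ x, e x = f x) ∧
      ContDiffOn ℝ ∞ e.symm e.target := by
  have hfa : ContDiffAt ℝ ∞ f a := hf.contDiffAt (hU.mem_nhds ha)
  let e₀ := hfa.toOpenPartialHomeomorph f hL (by simp)
  have hcont : ContinuousOn (fderiv ℝ f) U :=
    (hf.fderiv_of_isOpen hU (m := ∞) (by simp)).continuousOn
  let V : Set E := U ∩ fderiv ℝ f ⁻¹' range ((↑) : (E ≃L[ℝ] E) → E →L[ℝ] E)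
  have hV : IsOpen V := hcont.isOpen_inter_preimage hU (ContinuousLinearEquiv.isOpen)
  refine ⟨e₀.restrOpen V hV, ⟨hfa.mem_toOpenPartialHomeomorph_source hL (by simp), ha, L,
    hL.fderiv.symm⟩, fun x hx => hx.2.1, fun x => rfl, fun y hy => ?_⟩
  have hx := (e₀.restrOpen V hV).map_target hy
  obtain ⟨-, hxU, A, hA⟩ := hx
  have hfx := hf.contDiffAt (hU.mem_nhds hxU)
  refine ((e₀.restrOpen V hV).contDiffAt_symm (f₀' := A) hy ?_ hfx).contDiffWithinAt
  rw [hA]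
  exact (hfx.differentiableAt (by simp)).hasFDerivAt

theorem PointGroup.fderiv_flow {k : ℕ} (G : PointGroup k) {z : Base k} (hz : z ∈ G.M) (s : ℝ)
    (v : Base k) :
    fderiv ℝ (fun w : ℝ × Base k => G.φ w.1 w.2) (0, z) (s, v) = s • G.generator z + v := by
  have h0 := G.zero_mem z hz
  have hF := ((G.contDiffAt h0).differentiableAt (by simp)).hasFDerivAt
  have h1 : fderiv ℝ (fun w : ℝ × Base k => G.φ w.1 w.2) (0, z) (1, 0) = G.generator z := by
    have h2 : HasDerivAt (fun ε : ℝ => (ε, z)) ((1 : ℝ), (0 : Base k)) 0 :=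
      (hasDerivAt_id _).prodMk (hasDerivAt_const _ _)
    have h3 := hF.comp_hasDerivAt (f := fun ε : ℝ => (ε, z)) 0 h2
    have h4 := G.hasDerivAt_flow h0
    rw [G.map_zero z hz] at h4
    exact h3.unique h4
  have h2 : fderiv ℝ (fun w : ℝ × Base k => G.φ w.1 w.2) (0, z) (0, v) = v := by
    have h3 : HasFDerivAt (fun y : Base k => ((0 : ℝ), y))
        (ContinuousLinearMap.inr ℝ ℝ (Base k)) z := hasFDerivAt_prodMk_right _ _
    have h4 := hF.comp (f := fun y : Base k => ((0 : ℝ), y)) z h3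
    have h5 : HasFDerivAt (fun y : Base k => y) (ContinuousLinearMap.id ℝ (Base k)) z :=
      hasFDerivAt_id z
    have h6 : ((fun w : ℝ × Base k => G.φ w.1 w.2) ∘ fun y : Base k => ((0 : ℝ), y))
        =ᶠ[nhds z] fun y => y := by
      filter_upwards [G.isOpen_M.mem_nhds hz] with y hy
      exact G.map_zero y hy
    have := h4.unique (h5.congr_of_eventuallyEq h6)
    simpa using! congrArg (fun A : Base k →L[ℝ] Base k => A v) this
  have h3 : ((s, v) : ℝ × Base k) = s • (1, 0) + (0, v) := by ext <;> simp
  rw [h3, map_add, map_smul, h1, h2]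

/-- The value of `U¹`, as a continuous linear form. -/
noncomputable def coordU1 (n : ℕ) : Base (n + 1) →L[ℝ] ℝ :=
  (ContinuousLinearMap.proj 0).comp (ContinuousLinearMap.snd ℝ (ℝ × ℝ) (Fin (n + 1) → ℝ))

@[simp] theorem coordU1_eU (n : ℕ) : coordU1 n (eU n) = 1 := by simp [coordU1, eU]

theorem eU_ne_zero (n : ℕ) : eU n ≠ 0 := fun h => by
  have := coordU1_eU n
  rw [h, map_zero] at this
  exact zero_ne_one this

/-- Straightening of the generator: the inverse of the coordinates carries `(X, T, U¹, Û)` along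
the group by the time `U¹`, starting at the point `(X, T, 0, Û)` of a hyperplane transversal to
the generator. -/
theorem exists_canonicalCoordinates {n : ℕ} (G : PointGroup (n + 1)) {z₀ : Base (n + 1)}
    (hz₀ : z₀ ∈ G.M) (hne : G.generator z₀ ≠ 0) :
    ∃ K : CanonicalCoordinates G, z₀ ∈ K.Φ.source := by
  obtain ⟨L, hL⟩ := SeparatingDual.exists_continuousLinearEquiv_apply_eq (R := ℝ)
    (eU_ne_zero n) hne
  let P : Base (n + 1) →L[ℝ] Base (n + 1) :=
    (L : Base (n + 1) →L[ℝ] Base (n + 1)).comp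
      (ContinuousLinearMap.id ℝ _ - (coordU1 n).smulRight (eU n))
  have hP : ∀ w, P w = L w - coordU1 n w • G.generator z₀ := fun w => by
    simp [P, hL]
  let g : Base (n + 1) → ℝ × Base (n + 1) := fun w => (coordU1 n w, z₀ + P w)
  let Ψ : Base (n + 1) → Base (n + 1) := fun w => G.φ (g w).1 (g w).2
  have hg : ContDiff ℝ ∞ g := by fun_prop
  have hg0 : g 0 = (0, z₀) := by simp [g]
  let U : Set (Base (n + 1)) := g ⁻¹' G.flowDom
  have hU : IsOpen U := G.isOpen_flowDom.preimage hg.continuous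
  have h0U : (0 : Base (n + 1)) ∈ U := by
    change g 0 ∈ G.flowDom
    rw [hg0]
    exact G.zero_mem z₀ hz₀
  have hΨ : ContDiffOn ℝ ∞ Ψ U := G.smooth.comp hg.contDiffOn fun w hw => hw
  have hΨ0 : HasFDerivAt Ψ (L : Base (n + 1) →L[ℝ] Base (n + 1)) 0 := by
    have h1 : HasFDerivAt g ((coordU1 n).prod P) 0 :=
      (coordU1 n).hasFDerivAt.prodMk (P.hasFDerivAt.const_add z₀)
    have h2 : HasFDerivAt (fun w : ℝ × Base (n + 1) => G.φ w.1 w.2)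
        (fderiv ℝ (fun w : ℝ × Base (n + 1) => G.φ w.1 w.2) (0, z₀)) (g 0) := by
      rw [hg0]
      exact ((G.contDiffAt (G.zero_mem z₀ hz₀)).differentiableAt (by simp)).hasFDerivAt
    refine (h2.comp 0 h1).congr_fderiv (ContinuousLinearMap.ext fun w => ?_)
    rw [ContinuousLinearMap.comp_apply, ContinuousLinearMap.prod_apply, G.fderiv_flow hz₀, hP]
    simp
  obtain ⟨e, h0e, heU, heΨ, hsymm⟩ := exists_smooth_local_inverse hU hΨ h0U L hΨ0
  obtain ⟨r, hr, hball⟩ := Metric.isOpen_iff.1 e.open_source 0 h0e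
  let e' := e.restrOpen (Metric.ball 0 r) Metric.isOpen_ball
  have hsource : e'.source = Metric.ball 0 r := inter_eq_right.2 hball
  have he'e : ∀ x, e' x = Ψ x := heΨ
  have hsub : e'.target ⊆ e.target := inter_subset_left
  have hsmooth : ContDiffOn ℝ ∞ e'.symm e'.target := hsymm.mono hsub
  have hmemU : ∀ w ∈ e'.source, w ∈ U := fun w hw => heU hw.1
  refine ⟨{ Φ := e'.symm, source_subset := ?_, smooth := hsmooth, smooth_symm := ?_,
            canonical := ?_, interval := ?_ }, ?_⟩
  · intro z hz
    rw [← e'.right_inv hz, he'e]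
    exact G.maps (hmemU _ (e'.map_target hz))
  · exact (hΨ.mono hmemU).congr fun x _ => he'e x
  · intro z hz
    have hw := e'.map_target hz
    set w := e'.symm z with hwz
    have hzw : z = Ψ w := by rw [← he'e, hwz, e'.right_inv hz]
    have h1 : HasDerivAt (fun s : ℝ => Ψ (w + s • eU n)) (G.generator z) 0 := by
      have hgs : ∀ s : ℝ, g (w + s • eU n) = (coordU1 n w + s, (g w).2) := fun s => by
        refine Prod.ext ?_ ?_
        · simp [g]
        · simp only [g, hP, hL, map_add, map_smul, coordU1_eU, smul_eq_mul, mul_one]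
          module
      have h2 : HasDerivAt (fun ε => G.φ ε (g w).2) (G.generator z) (coordU1 n w + 0) := by
        rw [hzw, add_zero]
        exact G.hasDerivAt_flow (hmemU w hw)
      have h3 := h2.comp_const_add (coordU1 n w) 0
      simpa only [Ψ, hgs] using h3
    have h4 : HasFDerivAt e'.symm (fderiv ℝ e'.symm z) (Ψ (w + (0 : ℝ) • eU n)) := by
      rw [zero_smul, add_zero, ← hzw]
      exact ((hsmooth.contDiffAt (e'.open_target.mem_nhds hz)).differentiableAt
        (by simp)).hasFDerivAt
    have h5 := h4.comp_hasDerivAt (f := fun s : ℝ => Ψ (w + s • eU n)) 0 h1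
    have h6 : (fun s : ℝ => w + s • eU n) =ᶠ[nhds 0]
        (e'.symm ∘ fun s : ℝ => Ψ (w + s • eU n)) := by
      have hcont : ContinuousAt (fun s : ℝ => w + s • eU n) 0 := by fun_prop
      have hmem : e'.source ∈ nhds (w + (0 : ℝ) • eU n) := by
        rw [zero_smul, add_zero]
        exact e'.open_source.mem_nhds hw
      filter_upwards [hcont.preimage_mem_nhds hmem] with s hs
      rw [Function.comp_apply, ← he'e, e'.left_inv hs]
    have h7 : HasDerivAt (fun s : ℝ => w + s • eU n) (eU n) 0 := by
      simpa using! ((hasDerivAt_id (0 : ℝ)).smul_const (eU n)).const_add w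
    exact (h5.congr_of_eventuallyEq h6).unique h7
  · intro w
    have h1 : Convex ℝ {c : ℝ | w + c • eU n ∈ e'.source} := by
      rw [hsource]
      have := (convex_ball (0 : Base (n + 1)) r).affine_preimage
        (AffineMap.lineMap w (w + eU n) : ℝ →ᵃ[ℝ] Base (n + 1))
      simpa [AffineMap.lineMap_apply, preimage, add_comm] using this
    exact h1.ordConnected
  · have h1 : e' 0 = z₀ := by
      rw [he'e]
      simp only [Ψ, hg0, G.map_zero z₀ hz₀]
    have h2 : (0 : Base (n + 1)) ∈ e'.source := ⟨h0e, Metric.mem_ball_self hr⟩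
    exact h1 ▸ e'.map_source h2

/-! ### Functions in new variables, locally -/

theorem isOpen_setOf_shift_mem {n : ℕ} {Φ : OpenPartialHomeomorph (Base (n + 1)) (Base (n + 1))}
    {D : Set (ℝ × ℝ)} {U : ℝ × ℝ → Fin (n + 1) → ℝ} (hD : IsOpen D) (hU : ContDiffOn ℝ ∞ U D) :
    IsOpen {w : (ℝ × ℝ) × ℝ | w.1 ∈ D ∧ (w.1, shift w.2 U w.1) ∈ Φ.target} := by
  have h1 : ContinuousOn (fun w : (ℝ × ℝ) × ℝ => (w.1, shift w.2 U w.1)) (Prod.fst ⁻¹' D) := by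
    refine continuousOn_fst.prodMk ((hU.continuousOn.comp continuousOn_fst fun w hw => hw).add ?_)
    exact ((continuous_single (A := fun _ : Fin (n + 1) => ℝ) 0).comp
      continuous_snd).continuousOn
  exact h1.isOpen_inter_preimage (hD.preimage continuous_fst) Φ.open_target

/-- Where `(x, t)` can serve as independent variables on the graph of `U`, the translates of `U`
by small constants all correspond over one and the same neighbourhood to functions of the original
variables. The uniformity comes from the inverse function theorem with the constant as a
parameter. The set `W` allows to impose further open conditions on that neighbourhood. -/
theorem exists_corresponds_family {n : ℕ}
    {Φ : OpenPartialHomeomorph (Base (n + 1)) (Base (n + 1))}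
    (hΦ : ContDiffOn ℝ ∞ Φ.symm Φ.target) {D' : Set (ℝ × ℝ)} {U : ℝ × ℝ → Fin (n + 1) → ℝ}
    (hD' : IsOpen D') (hU : ContDiffOn ℝ ∞ U D') {q₀ : ℝ × ℝ} (hq₀ : q₀ ∈ D')
    (ht : (q₀, U q₀) ∈ Φ.target) (hinj : Function.Injective (fderiv ℝ (baseMap Φ U) q₀))
    {W : Set ((ℝ × ℝ) × ℝ)} (hW : W ∈ nhds (q₀, (0 : ℝ))) :
    ∃ D₀ ⊆ D', IsOpen D₀ ∧ q₀ ∈ D₀ ∧ ∃ δ > 0, ∀ c : ℝ, |c| < δ →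
      (∀ q ∈ D₀, (q, c) ∈ W) ∧ ∃ D u, Corresponds Φ D u D₀ (shift c U) := by
  set V₀ : Set ((ℝ × ℝ) × ℝ) := {w | w.1 ∈ D' ∧ (w.1, shift w.2 U w.1) ∈ Φ.target} with hV₀
  have hV₀o : IsOpen V₀ := isOpen_setOf_shift_mem hD' hU
  have hq₀V₀ : (q₀, (0 : ℝ)) ∈ V₀ := ⟨hq₀, by simpa using ht⟩
  let V : Set ((ℝ × ℝ) × ℝ) := V₀ ∩ interior W
  have hVo : IsOpen V := hV₀o.inter isOpen_interior
  have hq₀V : (q₀, (0 : ℝ)) ∈ V := ⟨hq₀V₀, mem_interior_iff_mem_nhds.2 hW⟩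
  let m : (ℝ × ℝ) × ℝ → ℝ × ℝ := fun w => baseMap Φ (shift w.2 U) w.1
  let M : (ℝ × ℝ) × ℝ → (ℝ × ℝ) × ℝ := fun w => (m w, w.2)
  have hsingle : ContDiff ℝ ∞ (fun w : (ℝ × ℝ) × ℝ =>
      (Pi.single (0 : Fin (n + 1)) w.2 : Fin (n + 1) → ℝ)) :=
    (ContinuousLinearMap.single ℝ (fun _ : Fin (n + 1) => ℝ) 0).contDiff.comp contDiff_snd
  have hgraph : ContDiffOn ℝ ∞ (fun w : (ℝ × ℝ) × ℝ => (w.1, shift w.2 U w.1)) V₀ :=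
    contDiffOn_fst.prodMk ((hU.comp contDiffOn_fst fun w hw => hw.1).add hsingle.contDiffOn)
  have hΨ : ContDiffOn ℝ ∞ (fun w : (ℝ × ℝ) × ℝ => Φ.symm (w.1, shift w.2 U w.1)) V₀ :=
    hΦ.comp hgraph fun w hw => hw.2
  have hm : ContDiffOn ℝ ∞ m V₀ := contDiff_fst.comp_contDiffOn hΨ
  have hM : ContDiffOn ℝ ∞ M V := (hm.prodMk contDiffOn_snd).mono inter_subset_left
  have hm0 : HasFDerivAt m (fderiv ℝ m (q₀, 0)) (q₀, 0) :=
    ((hm.contDiffAt (hV₀o.mem_nhds hq₀V₀)).differentiableAt (by simp)).hasFDerivAt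
  have hM0 : HasFDerivAt M ((fderiv ℝ m (q₀, 0)).prod (ContinuousLinearMap.snd ℝ (ℝ × ℝ) ℝ))
      (q₀, 0) := hm0.prodMk hasFDerivAt_snd
  have hpartial : ∀ v, fderiv ℝ m (q₀, 0) (v, 0) = fderiv ℝ (baseMap Φ U) q₀ v := by
    intro v
    have h1 := hm0.comp (f := fun q : ℝ × ℝ => (q, (0 : ℝ))) q₀ (hasFDerivAt_prodMk_left _ _)
    have h2 : (m ∘ fun q : ℝ × ℝ => (q, (0 : ℝ))) = baseMap Φ U := by
      funext q
      simp [m]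
    rw [h2] at h1
    rw [h1.fderiv]
    rfl
  have hMinj : Function.Injective
      ((fderiv ℝ m (q₀, 0)).prod (ContinuousLinearMap.snd ℝ (ℝ × ℝ) ℝ)) := by
    rw [injective_iff_map_eq_zero]
    rintro ⟨v, s⟩ h
    rw [ContinuousLinearMap.prod_apply, Prod.mk_eq_zero] at h
    obtain ⟨h1, rfl : s = 0⟩ := h
    rw [hpartial] at h1
    rw [hinj (h1.trans (map_zero _).symm)]
    rfl
  let L : ((ℝ × ℝ) × ℝ) ≃L[ℝ] ((ℝ × ℝ) × ℝ) :=
    (LinearEquiv.ofInjectiveEndo _ hMinj).toContinuousLinearEquiv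
  obtain ⟨e, hqe, heV, heM, hsymm⟩ := exists_smooth_local_inverse hVo hM hq₀V L hM0
  have hnhds : e.source ∈ nhds (q₀, (0 : ℝ)) := e.open_source.mem_nhds hqe
  rw [mem_nhds_prod_iff'] at hnhds
  obtain ⟨D₀, T, hD₀, hq₀D₀, hT, h0T, hsub⟩ := hnhds
  obtain ⟨δ, hδ, hball⟩ := Metric.isOpen_iff.1 hT 0 h0T
  have hsource : ∀ q ∈ D₀, ∀ c : ℝ, |c| < δ → (q, c) ∈ e.source := fun q hq c hc =>
    hsub ⟨hq, hball (by simpa using hc)⟩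
  have hsubD' : D₀ ⊆ D' := fun q hq =>
    (heV (hsource q hq 0 (by simpa using hδ))).1.1
  refine ⟨D₀, hsubD', hD₀, hq₀D₀, δ, hδ, fun c hc =>
    ⟨fun q hq => interior_subset (heV (hsource q hq c hc)).2, ?_⟩⟩
  let r : ℝ × ℝ → ℝ × ℝ := fun p => (e.symm (p, c)).1
  let D : Set (ℝ × ℝ) := {p | (p, c) ∈ e.target ∧ r p ∈ D₀}
  have hr : ∀ p ∈ D, e.symm (p, c) = (r p, c) ∧ m (r p, c) = p := by
    intro p hp
    have h1 : M (e.symm (p, c)) = (p, c) := by rw [← heM, e.right_inv hp.1]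
    have h2 : e.symm (p, c) = (r p, c) :=
      Prod.ext rfl (show (e.symm (p, c)).2 = c from congrArg Prod.snd h1)
    rw [h2] at h1
    exact ⟨h2, congrArg Prod.fst h1⟩
  have hmr : ∀ q ∈ D₀, m (q, c) ∈ D ∧ r (m (q, c)) = q := by
    intro q hq
    have h1 : e (q, c) = (m (q, c), c) := heM _
    have h2 := hsource q hq c hc
    have h3 : r (m (q, c)) = q := by
      change (e.symm (m (q, c), c)).1 = q
      rw [← h1, e.left_inv h2]
    exact ⟨⟨h1 ▸ e.map_source h2, h3.symm ▸ hq⟩, h3⟩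
  have hslice : ContDiff ℝ ∞ (fun p : ℝ × ℝ => (p, c)) := by fun_prop
  have hrs : ContDiffOn ℝ ∞ r ((fun p : ℝ × ℝ => (p, c)) ⁻¹' e.target) :=
    contDiff_fst.comp_contDiffOn (hsymm.comp hslice.contDiffOn fun p hp => hp)
  have hDo : IsOpen D :=
    hrs.continuousOn.isOpen_inter_preimage (e.open_target.preimage hslice.continuous) hD₀
  have htarget : ∀ q ∈ D₀, (q, shift c U q) ∈ Φ.target := fun q hq =>
    (heV (hsource q hq c hc)).1.2
  refine ⟨D, fun p => (Φ.symm (r p, shift c U (r p))).2, Corresponds.symm (Φ := Φ.symm) ?_⟩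
  refine ⟨hD₀, contDiffOn_shift (hU.mono hsubD') c, hDo, ?_, ?_, ?_⟩
  · refine contDiff_snd.comp_contDiffOn (hΨ.comp
      (g := fun w : (ℝ × ℝ) × ℝ => Φ.symm (w.1, shift w.2 U w.1)) (f := fun p => (r p, c))
      ((hrs.mono fun p hp => hp.1).prodMk contDiffOn_const) fun p hp => ?_)
    exact ⟨hsubD' hp.2, htarget _ hp.2⟩
  · rintro _ ⟨q, hq, rfl⟩
    exact htarget q hq
  · ext z
    constructor
    · rintro ⟨_, ⟨q, hq, rfl⟩, rfl⟩
      obtain ⟨h1, h2⟩ := hmr q hq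
      refine ⟨m (q, c), h1, ?_⟩
      beta_reduce
      rw [h2]
      rfl
    · rintro ⟨p, hp, rfl⟩
      refine ⟨_, ⟨r p, hp.2, rfl⟩, ?_⟩
      exact Prod.ext (hr p hp).2 rfl

/-! ### Prolongation of a change of variables to jets -/

/-- The index of `∂_X^i ∂_T^j`, now among those of order at most `N + 1`. -/
def MIdx.castSucc {N : ℕ} (μ : MIdx N) : MIdx (N + 1) :=
  ⟨(μ.1.1.castSucc, μ.1.2.castSucc), by have := μ.2; simp only [Fin.val_castSucc]; omega⟩

/-- The index of `∂_X^(i+1) ∂_T^j`. -/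
def MIdx.succX {N : ℕ} (μ : MIdx N) : MIdx (N + 1) :=
  ⟨(μ.1.1.succ, μ.1.2.castSucc), by
    have := μ.2; simp only [Fin.val_castSucc, Fin.val_succ]; omega⟩

/-- The index of `∂_X^i ∂_T^(j+1)`. -/
def MIdx.succT {N : ℕ} (μ : MIdx N) : MIdx (N + 1) :=
  ⟨(μ.1.1.castSucc, μ.1.2.succ), by
    have := μ.2; simp only [Fin.val_castSucc, Fin.val_succ]; omega⟩

/-- The jet of order `N` underlying a jet of order `N + 1`. -/
def Jet.trunc {k N : ℕ} (J : Jet k (N + 1)) : Jet k N := (J.1, fun a μ => J.2 a μ.castSucc)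

/-- The point `(X, T, U)` underlying a jet. -/
def Jet.base {k N : ℕ} (J : Jet k N) : Base k := (J.1, fun a => J.2 a (MIdx.zero N))

/-- The velocity of the `N`-jet of a function when the base point moves with velocity `v`, as a
function of the `(N + 1)`-jet. -/
def Jet.velocity {k N : ℕ} (v : ℝ × ℝ) (J : Jet k (N + 1)) : Jet k N :=
  (v, fun a μ => v.1 * J.2 a μ.succX + v.2 * J.2 a μ.succT)

/-- The total derivative, in the direction `v`, of a function of `N`-jets. -/
noncomputable def totalDeriv {k N : ℕ} {E : Type*} [NormedAddCommGroup E] [NormedSpace ℝ E]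
    (v : ℝ × ℝ) (F : Jet k N → E) (J : Jet k (N + 1)) : E :=
  fderiv ℝ F J.trunc (J.velocity v)

theorem contDiff_trunc {k N : ℕ} : ContDiff ℝ ∞ (Jet.trunc (k := k) (N := N)) := by
  unfold Jet.trunc; fun_prop

theorem contDiff_base {k N : ℕ} : ContDiff ℝ ∞ (Jet.base (k := k) (N := N)) := by
  unfold Jet.base; fun_prop

theorem contDiff_velocity {k N : ℕ} (v : ℝ × ℝ) :
    ContDiff ℝ ∞ (Jet.velocity (k := k) (N := N) v) := by
  unfold Jet.velocity; fun_prop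

theorem contDiffOn_totalDeriv {k N : ℕ} {E : Type*} [NormedAddCommGroup E] [NormedSpace ℝ E]
    (v : ℝ × ℝ) {F : Jet k N → E} {O : Set (Jet k N)} (hO : IsOpen O)
    (hF : ContDiffOn ℝ ∞ F O) : ContDiffOn ℝ ∞ (totalDeriv v F) (Jet.trunc ⁻¹' O) :=
  ((hF.fderiv_of_isOpen hO (m := ∞) (by simp)).comp contDiff_trunc.contDiffOn
    fun _ hJ => hJ).clm_apply (contDiff_velocity v).contDiffOn

theorem base_jet {k : ℕ} (N : ℕ) (u : ℝ × ℝ → Fin k → ℝ) (p : ℝ × ℝ) :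
    (jet N u p).base = (p, u p) := rfl

theorem fderiv_jet_apply {k : ℕ} {u : ℝ × ℝ → Fin k → ℝ} {D : Set (ℝ × ℝ)} (hD : IsOpen D)
    (hu : ContDiffOn ℝ ∞ u D) (N : ℕ) {p : ℝ × ℝ} (hp : p ∈ D) (v : ℝ × ℝ) :
    fderiv ℝ (jet N u) p v = (jet (N + 1) u p).velocity v := by
  have hd : ∀ a (μ : MIdx N), DifferentiableAt ℝ (pd μ.1.1 μ.1.2 (fun q => u q a)) p :=
    fun a μ => (((contDiffOn_component hu a).pd hD _ _).contDiffAt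
      (hD.mem_nhds hp)).differentiableAt (by simp)
  have h1 : HasFDerivAt (jet N u) ((ContinuousLinearMap.id ℝ (ℝ × ℝ)).prod
      (ContinuousLinearMap.pi fun a => ContinuousLinearMap.pi fun μ : MIdx N =>
        fderiv ℝ (pd μ.1.1 μ.1.2 (fun q => u q a)) p)) p :=
    (hasFDerivAt_id p).prodMk (hasFDerivAt_pi.2 fun a => hasFDerivAt_pi.2 fun μ =>
      (hd a μ).hasFDerivAt)
  rw [h1.fderiv]
  refine Prod.ext rfl (funext fun a => funext fun μ => ?_)
  change fderiv ℝ (pd μ.1.1 μ.1.2 (fun q => u q a)) p v = _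
  rw [fderiv_apply_eq_pd, pdX_pd, pdT_pd (contDiffOn_component hu a) hD _ _ hp]
  rfl

/-- The chain rule for a function of the jet. -/
theorem fderiv_comp_jet {k N : ℕ} {E : Type*} [NormedAddCommGroup E] [NormedSpace ℝ E]
    {F : Jet k N → E} {O : Set (Jet k N)} (hO : IsOpen O) (hF : ContDiffOn ℝ ∞ F O)
    {u : ℝ × ℝ → Fin k → ℝ} {D : Set (ℝ × ℝ)} (hD : IsOpen D) (hu : ContDiffOn ℝ ∞ u D)
    {p : ℝ × ℝ} (hp : p ∈ D) (hj : jet N u p ∈ O) (v : ℝ × ℝ) :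
    fderiv ℝ (fun q => F (jet N u q)) p v = totalDeriv v F (jet (N + 1) u p) := by
  have h1 : DifferentiableAt ℝ F (jet N u p) :=
    (hF.contDiffAt (hO.mem_nhds hj)).differentiableAt (by simp)
  have h2 : DifferentiableAt ℝ (jet N u) p :=
    ((contDiffOn_jet hD hu N).contDiffAt (hD.mem_nhds hp)).differentiableAt (by simp)
  rw [fderiv_fun_comp p h1 h2, ContinuousLinearMap.comp_apply, fderiv_jet_apply hD hu N hp]
  rfl

/-- The determinant of two vectors of the plane. -/
def det₂ (a b : ℝ × ℝ) : ℝ := a.1 * b.2 - a.2 * b.1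

theorem injective_iff_det₂_ne_zero (A : ℝ × ℝ →L[ℝ] ℝ × ℝ) :
    Function.Injective A ↔ det₂ (A (1, 0)) (A (0, 1)) ≠ 0 := by
  have hA : ∀ v : ℝ × ℝ, A v = v.1 • A (1, 0) + v.2 • A (0, 1) := fun v => by
    rw [← map_smul, ← map_smul, ← map_add]
    congr 1
    ext <;> simp
  set a := A (1, 0)
  set b := A (0, 1)
  constructor
  · intro h hdet
    have h0 : ∀ v : ℝ × ℝ, A v = 0 → v = 0 := fun v hv => h (hv.trans (map_zero A).symm)
    unfold det₂ at hdet
    have h1 := h0 (b.2, -a.2) (by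
      rw [hA]
      refine Prod.ext ?_ ?_ <;> simp <;> linarith)
    have h2 := h0 (b.1, -a.1) (by
      rw [hA]
      refine Prod.ext ?_ ?_ <;> simp <;> linarith)
    simp only [Prod.mk_eq_zero, neg_eq_zero] at h1 h2
    have ha : a = 0 := Prod.ext h2.2 h1.2
    have := h0 (1, 0) ha
    simp at this
  · intro hdet
    rw [injective_iff_map_eq_zero]
    intro v hv
    rw [hA] at hv
    have h1 : v.1 * a.1 + v.2 * b.1 = 0 := by simpa using congrArg Prod.fst hv
    have h2 : v.1 * a.2 + v.2 * b.2 = 0 := by simpa using congrArg Prod.snd hv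
    refine Prod.ext ?_ ?_
    · refine (mul_eq_zero.1 (?_ : v.1 * det₂ a b = 0)).resolve_right hdet
      unfold det₂
      linear_combination b.2 * h1 - b.1 * h2
    · refine (mul_eq_zero.1 (?_ : v.2 * det₂ a b = 0)).resolve_right hdet
      unfold det₂
      linear_combination a.1 * h2 - a.2 * h1

section Prolongation

variable {k : ℕ}

/-- The old independent variables, as a function on `0`-jets in the new variables. -/
noncomputable def oldXT (Φ : OpenPartialHomeomorph (Base k) (Base k)) (J : Jet k 0) : ℝ × ℝ :=
  (Φ.symm J.base).1

/-- The jet of order one underlying a jet of positive order. -/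
def Jet.firstOrder {N : ℕ} (J : Jet k (N + 1)) : Jet k 1 :=
  (J.1, fun a μ => J.2 a ⟨(Fin.castLE (by omega) μ.1.1, Fin.castLE (by omega) μ.1.2), by
    have := μ.2; simp only [Fin.val_castLE]; omega⟩)

theorem contDiff_firstOrder {N : ℕ} : ContDiff ℝ ∞ (Jet.firstOrder (k := k) (N := N)) := by
  unfold Jet.firstOrder; fun_prop

/-- The total Jacobian of the old with respect to the new independent variables, at a jet of
positive order. -/
noncomputable def jetJacobian (Φ : OpenPartialHomeomorph (Base k) (Base k)) {N : ℕ}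
    (J : Jet k (N + 1)) : ℝ :=
  det₂ (totalDeriv (1, 0) (oldXT Φ) J.firstOrder) (totalDeriv (0, 1) (oldXT Φ) J.firstOrder)

/-- The jets to which the inverse of `Φ` can be prolonged: those over the range of `Φ` at
which, for positive order, the old independent variables can serve as such. -/
def prolDom (Φ : OpenPartialHomeomorph (Base k) (Base k)) : ∀ N : ℕ, Set (Jet k N)
  | 0 => {J | J.base ∈ Φ.target}
  | _ + 1 => {J | J.base ∈ Φ.target ∧ jetJacobian Φ J ≠ 0}

variable {Φ : OpenPartialHomeomorph (Base k) (Base k)}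

theorem base_mem_of_mem_prolDom {N : ℕ} {J : Jet k N} (h : J ∈ prolDom Φ N) :
    J.base ∈ Φ.target := by
  cases N with
  | zero => exact h
  | succ N => exact h.1

theorem trunc_mem_prolDom {N : ℕ} {J : Jet k (N + 1)} (h : J ∈ prolDom Φ (N + 1)) :
    J.trunc ∈ prolDom Φ N := by
  cases N with
  | zero => exact h.1
  | succ N => exact h

theorem contDiffOn_oldXT (hΦ : ContDiffOn ℝ ∞ Φ.symm Φ.target) :
    ContDiffOn ℝ ∞ (oldXT Φ) (prolDom Φ 0) :=
  contDiff_fst.comp_contDiffOn (hΦ.comp contDiff_base.contDiffOn fun _ hJ => hJ)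

theorem isOpen_prolDom_zero : IsOpen (prolDom Φ 0) :=
  Φ.open_target.preimage contDiff_base.continuous

theorem contDiffOn_jetJacobian (hΦ : ContDiffOn ℝ ∞ Φ.symm Φ.target) (N : ℕ) :
    ContDiffOn ℝ ∞ (jetJacobian Φ (N := N)) {J | J.base ∈ Φ.target} := by
  have h1 : ∀ v, ContDiffOn ℝ ∞ (totalDeriv v (oldXT Φ)) (Jet.trunc ⁻¹' prolDom Φ 0) := fun v =>
    contDiffOn_totalDeriv v isOpen_prolDom_zero (contDiffOn_oldXT hΦ)
  have h2 : ContDiffOn ℝ ∞ (fun J => det₂ (totalDeriv (1, 0) (oldXT Φ) J)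
      (totalDeriv (0, 1) (oldXT Φ) J)) (Jet.trunc ⁻¹' prolDom Φ 0) :=
    ((h1 _).fst.mul (h1 _).snd).sub ((h1 _).snd.mul (h1 _).fst)
  exact h2.comp contDiff_firstOrder.contDiffOn fun J hJ => hJ

theorem isOpen_prolDom (hΦ : ContDiffOn ℝ ∞ Φ.symm Φ.target) (N : ℕ) :
    IsOpen (prolDom Φ N) := by
  cases N with
  | zero => exact isOpen_prolDom_zero
  | succ N =>
    exact (contDiffOn_jetJacobian hΦ N).continuousOn.isOpen_inter_preimage
      (Φ.open_target.preimage contDiff_base.continuous) isOpen_ne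

theorem fderiv_baseMap (hΦ : ContDiffOn ℝ ∞ Φ.symm Φ.target) {D : Set (ℝ × ℝ)}
    {U : ℝ × ℝ → Fin k → ℝ} (hD : IsOpen D) (hU : ContDiffOn ℝ ∞ U D) {q : ℝ × ℝ} (hq : q ∈ D)
    (ht : (q, U q) ∈ Φ.target) (v : ℝ × ℝ) :
    fderiv ℝ (baseMap Φ U) q v = totalDeriv v (oldXT Φ) (jet 1 U q) :=
  fderiv_comp_jet isOpen_prolDom_zero (contDiffOn_oldXT hΦ) hD hU hq ht v

theorem jetJacobian_jet (hΦ : ContDiffOn ℝ ∞ Φ.symm Φ.target) {D : Set (ℝ × ℝ)}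
    {U : ℝ × ℝ → Fin k → ℝ} (hD : IsOpen D) (hU : ContDiffOn ℝ ∞ U D) {q : ℝ × ℝ} (hq : q ∈ D)
    (ht : (q, U q) ∈ Φ.target) (N : ℕ) :
    jetJacobian Φ (jet (N + 1) U q)
      = det₂ (fderiv ℝ (baseMap Φ U) q (1, 0)) (fderiv ℝ (baseMap Φ U) q (0, 1)) := by
  rw [fderiv_baseMap hΦ hD hU hq ht, fderiv_baseMap hΦ hD hU hq ht]
  rfl

theorem injective_fderiv_baseMap_of_mem_prolDom (hΦ : ContDiffOn ℝ ∞ Φ.symm Φ.target)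
    {D : Set (ℝ × ℝ)} {U : ℝ × ℝ → Fin k → ℝ} (hD : IsOpen D) (hU : ContDiffOn ℝ ∞ U D)
    {q : ℝ × ℝ} (hq : q ∈ D) {N : ℕ} (hN : 1 ≤ N) (h : jet N U q ∈ prolDom Φ N) :
    Function.Injective (fderiv ℝ (baseMap Φ U) q) := by
  obtain ⟨N, rfl⟩ := Nat.exists_eq_add_of_le' hN
  rw [injective_iff_det₂_ne_zero, ← jetJacobian_jet hΦ hD hU hq h.1 N]
  exact h.2

theorem Corresponds.injective_fderiv_baseMap (hs : ContDiffOn ℝ ∞ Φ Φ.source)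
    (hΦ : ContDiffOn ℝ ∞ Φ.symm Φ.target) {D D' : Set (ℝ × ℝ)} {u U : ℝ × ℝ → Fin k → ℝ}
    (h : Corresponds Φ D u D' U) {q : ℝ × ℝ} (hq : q ∈ D') :
    Function.Injective (fderiv ℝ (baseMap Φ U) q) := by
  have hp := (h.baseMap_mem hq).1
  have h1 : DifferentiableAt ℝ (baseMap Φ U) q :=
    ((contDiffOn_baseMap hΦ h.2.2.2.1 fun q hq => h.mem_target hq).contDiffAt
      (h.2.2.1.mem_nhds hq)).differentiableAt (by simp)
  have h2 : DifferentiableAt ℝ (baseMap Φ.symm u) (baseMap Φ U q) :=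
    ((contDiffOn_baseMap (Φ := Φ.symm) (by simpa using hs) h.2.1
      fun p hp => h.symm.mem_target hp).contDiffAt (h.1.mem_nhds hp)).differentiableAt (by simp)
  have h3 : (fun q => baseMap Φ.symm u (baseMap Φ U q)) =ᶠ[nhds q] id := by
    filter_upwards [h.2.2.1.mem_nhds hq] with r hr
    exact h.baseMap_baseMap hr
  have h4 := h3.fderiv_eq (𝕜 := ℝ)
  rw [fderiv_fun_comp q h2 h1, fderiv_id] at h4
  refine Function.LeftInverse.injective (g := fderiv ℝ (baseMap Φ.symm u) (baseMap Φ U q))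
    fun v => ?_
  exact congrArg (fun A : ℝ × ℝ →L[ℝ] ℝ × ℝ => A v) h4

theorem Corresponds.jet_mem_prolDom (hs : ContDiffOn ℝ ∞ Φ Φ.source)
    (hΦ : ContDiffOn ℝ ∞ Φ.symm Φ.target) {D D' : Set (ℝ × ℝ)} {u U : ℝ × ℝ → Fin k → ℝ}
    (h : Corresponds Φ D u D' U) {q : ℝ × ℝ} (hq : q ∈ D') (N : ℕ) :
    jet N U q ∈ prolDom Φ N := by
  cases N with
  | zero => exact h.mem_target hq
  | succ N =>
    refine ⟨h.mem_target hq, ?_⟩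
    rw [jetJacobian_jet hΦ h.2.2.1 h.2.2.2.1 hq (h.mem_target hq),
      ← injective_iff_det₂_ne_zero]
    exact h.injective_fderiv_baseMap hs hΦ hq

/-- `F` expresses the quantity `g`, attached to the functions `u` of the old variables, through
the jets of the corresponding functions `U` of the new variables. -/
def Expresses (Φ : OpenPartialHomeomorph (Base k) (Base k)) {N : ℕ} (F : Jet k N → ℝ)
    (g : (ℝ × ℝ → Fin k → ℝ) → ℝ × ℝ → ℝ) : Prop :=
  ContDiffOn ℝ ∞ F (prolDom Φ N) ∧ ∀ D u D' U, Corresponds Φ D u D' U →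
    ∀ q ∈ D', g u (baseMap Φ U q) = F (jet N U q)

theorem Expresses.trunc {N : ℕ} {F : Jet k N → ℝ} {g : (ℝ × ℝ → Fin k → ℝ) → ℝ × ℝ → ℝ}
    (h : Expresses Φ F g) : Expresses Φ (N := N + 1) (fun J => F J.trunc) g :=
  ⟨h.1.comp contDiff_trunc.contDiffOn fun _ hJ => trunc_mem_prolDom hJ, h.2⟩

/-- The recursion of prolongation: if a quantity can be expressed through the `N`-jet, its partial
derivatives can be expressed through the `(N + 1)`-jet, by Cramer's rule. -/
theorem Expresses.partials (hs : ContDiffOn ℝ ∞ Φ Φ.source)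
    (hΦ : ContDiffOn ℝ ∞ Φ.symm Φ.target) {N : ℕ} {F : Jet k N → ℝ}
    {g : (ℝ × ℝ → Fin k → ℝ) → ℝ × ℝ → ℝ} (h : Expresses Φ F g)
    (hg : ∀ D u, IsOpen D → ContDiffOn ℝ ∞ u D → ContDiffOn ℝ ∞ (g u) D) :
    (∃ F₁ : Jet k (N + 1) → ℝ, Expresses Φ F₁ fun u => pdX (g u)) ∧
      ∃ F₂ : Jet k (N + 1) → ℝ, Expresses Φ F₂ fun u => pdT (g u) := by
  let a : Jet k (N + 1) → ℝ × ℝ := fun J => totalDeriv (1, 0) (oldXT Φ) J.firstOrder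
  let b : Jet k (N + 1) → ℝ × ℝ := fun J => totalDeriv (0, 1) (oldXT Φ) J.firstOrder
  have hab : ∀ v, ContDiffOn ℝ ∞ (fun J => totalDeriv v (oldXT Φ) J.firstOrder)
      (prolDom Φ (N + 1)) := fun v =>
    (contDiffOn_totalDeriv v isOpen_prolDom_zero (contDiffOn_oldXT hΦ)).comp
      contDiff_firstOrder.contDiffOn fun J hJ => hJ.1
  have hjac : ∀ J ∈ prolDom Φ (N + 1), det₂ (a J) (b J) ≠ 0 := fun J hJ => hJ.2
  have hdet : ContDiffOn ℝ ∞ (fun J => det₂ (a J) (b J)) (prolDom Φ (N + 1)) :=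
    ((hab _).fst.mul (hab _).snd).sub ((hab _).snd.mul (hab _).fst)
  have hF : ∀ v, ContDiffOn ℝ ∞ (totalDeriv v F) (prolDom Φ (N + 1)) := fun v =>
    (contDiffOn_totalDeriv v (isOpen_prolDom hΦ N) h.1).mono fun J hJ => trunc_mem_prolDom hJ
  -- The chain rule for `g u ∘ baseMap Φ U = F ∘ jet N U`.
  have hchain : ∀ D u D' U, Corresponds Φ D u D' U → ∀ q ∈ D', ∀ v : ℝ × ℝ,
      (fderiv ℝ (baseMap Φ U) q v).1 * pdX (g u) (baseMap Φ U q)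
        + (fderiv ℝ (baseMap Φ U) q v).2 * pdT (g u) (baseMap Φ U q)
        = totalDeriv v F (jet (N + 1) U q) := by
    intro D u D' U hc q hq v
    have hp := (hc.baseMap_mem hq).1
    have h1 : DifferentiableAt ℝ (baseMap Φ U) q :=
      ((contDiffOn_baseMap hΦ hc.2.2.2.1 fun q hq => hc.mem_target hq).contDiffAt
        (hc.2.2.1.mem_nhds hq)).differentiableAt (by simp)
    have h2 : DifferentiableAt ℝ (g u) (baseMap Φ U q) :=
      ((hg D u hc.1 hc.2.1).contDiffAt (hc.1.mem_nhds hp)).differentiableAt (by simp)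
    have h3 : (fun q => g u (baseMap Φ U q)) =ᶠ[nhds q] fun q => F (jet N U q) := by
      filter_upwards [hc.2.2.1.mem_nhds hq] with r hr
      exact h.2 D u D' U hc r hr
    rw [← fderiv_apply_eq_pd, ← fderiv_comp_jet (isOpen_prolDom hΦ N) h.1 hc.2.2.1 hc.2.2.2.1 hq
      (hc.jet_mem_prolDom hs hΦ hq N), ← h3.fderiv_eq, fderiv_fun_comp q h2 h1]
    rfl
  have hsolve : ∀ D u D' U, Corresponds Φ D u D' U → ∀ q ∈ D',
      (a (jet (N + 1) U q)).1 * pdX (g u) (baseMap Φ U q)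
        + (a (jet (N + 1) U q)).2 * pdT (g u) (baseMap Φ U q)
        = totalDeriv (1, 0) F (jet (N + 1) U q) ∧
      (b (jet (N + 1) U q)).1 * pdX (g u) (baseMap Φ U q)
        + (b (jet (N + 1) U q)).2 * pdT (g u) (baseMap Φ U q)
        = totalDeriv (0, 1) F (jet (N + 1) U q) := by
    intro D u D' U hc q hq
    have h1 := hchain D u D' U hc q hq (1, 0)
    have h2 := hchain D u D' U hc q hq (0, 1)
    rw [fderiv_baseMap hΦ hc.2.2.1 hc.2.2.2.1 hq (hc.mem_target hq)] at h1 h2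
    exact ⟨h1, h2⟩
  refine ⟨⟨fun J => (totalDeriv (1, 0) F J * (b J).2 - totalDeriv (0, 1) F J * (a J).2)
      / det₂ (a J) (b J), ?_, ?_⟩,
    ⟨fun J => (totalDeriv (0, 1) F J * (a J).1 - totalDeriv (1, 0) F J * (b J).1)
      / det₂ (a J) (b J), ?_, ?_⟩⟩
  · exact (((hF _).mul (hab _).snd).sub ((hF _).mul (hab _).snd)).div hdet hjac
  · intro D u D' U hc q hq
    obtain ⟨h1, h2⟩ := hsolve D u D' U hc q hq
    rw [eq_div_iff (hjac _ (hc.jet_mem_prolDom hs hΦ hq _)), ← h1, ← h2]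
    unfold det₂
    ring
  · exact (((hF _).mul (hab _).fst).sub ((hF _).mul (hab _).fst)).div hdet hjac
  · intro D u D' U hc q hq
    obtain ⟨h1, h2⟩ := hsolve D u D' U hc q hq
    rw [eq_div_iff (hjac _ (hc.jet_mem_prolDom hs hΦ hq _)), ← h1, ← h2]
    unfold det₂
    ring

theorem exists_expresses_pd (hs : ContDiffOn ℝ ∞ Φ Φ.source)
    (hΦ : ContDiffOn ℝ ∞ Φ.symm Φ.target) (a : Fin k) (N : ℕ) :
    ∀ i j : ℕ, i + j ≤ N →
      ∃ F : Jet k N → ℝ, Expresses Φ F fun u => pd i j (fun p => u p a) := by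
  have hg : ∀ i j : ℕ, ∀ D (u : ℝ × ℝ → Fin k → ℝ), IsOpen D → ContDiffOn ℝ ∞ u D →
      ContDiffOn ℝ ∞ (pd i j (fun p => u p a)) D := fun i j D u hD hu =>
    (contDiffOn_component hu a).pd hD i j
  induction N with
  | zero =>
    intro i j hij
    obtain ⟨rfl, rfl⟩ : i = 0 ∧ j = 0 := by omega
    refine ⟨fun J => (Φ.symm J.base).2 a, ?_, ?_⟩
    · exact contDiffOn_pi.1 (contDiff_snd.comp_contDiffOn
        (hΦ.comp contDiff_base.contDiffOn fun _ hJ => hJ)) a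
    · intro D u D' U hc q hq
      beta_reduce
      rw [base_jet, (hc.baseMap_mem hq).2]
      rfl
  | succ N ih =>
    intro i j hij
    rcases Nat.lt_or_ge (i + j) (N + 1) with h | h
    · obtain ⟨F, hF⟩ := ih i j (by omega)
      exact ⟨_, hF.trunc⟩
    · cases i with
      | succ i =>
        obtain ⟨F, hF⟩ := ih i j (by omega)
        simpa only [pdX_pd] using (hF.partials hs hΦ (hg i j)).1
      | zero =>
        obtain ⟨j, rfl⟩ : ∃ j', j = j' + 1 := ⟨j - 1, by omega⟩
        obtain ⟨F, hF⟩ := ih 0 j (by omega)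
        obtain ⟨F₂, hF₂⟩ := (hF.partials hs hΦ (hg 0 j)).2
        refine ⟨F₂, hF₂.1, fun D u D' U hc q hq => ?_⟩
        rw [← hF₂.2 D u D' U hc q hq]
        exact (pdT_pd (contDiffOn_component hc.2.1 a) hc.1 0 j (hc.baseMap_mem hq).1).symm

/-- The prolongation of the change of variables: the jet of `u` is a continuous function of the
jet of the corresponding `U`. -/
theorem exists_prolongation (hs : ContDiffOn ℝ ∞ Φ Φ.source)
    (hΦ : ContDiffOn ℝ ∞ Φ.symm Φ.target) (l : ℕ) :
    ∃ P : Jet k l → Jet k l, ContinuousOn P (prolDom Φ l) ∧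
      ∀ D u D' U, Corresponds Φ D u D' U → ∀ q ∈ D',
        jet l u (baseMap Φ U q) = P (jet l U q) := by
  choose F hF using fun (a : Fin k) (μ : MIdx l) =>
    exists_expresses_pd hs hΦ a l μ.1.1 μ.1.2 μ.2
  refine ⟨fun J => ((Φ.symm J.base).1, fun a μ => F a μ J), ?_, ?_⟩
  · refine ContinuousOn.prodMk ?_ (continuousOn_pi.2 fun a => continuousOn_pi.2 fun μ =>
      (hF a μ).1.continuousOn)
    exact continuous_fst.comp_continuousOn (hΦ.continuousOn.comp
      contDiff_base.continuous.continuousOn fun J hJ => base_mem_of_mem_prolDom hJ)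
  · intro D u D' U hc q hq
    exact Prod.ext rfl (funext fun a => funext fun μ => (hF a μ).2 D u D' U hc q hq)

end Prolongation

/-! ### The system in canonical coordinates -/

theorem jetShift_eq_of_forall_ne {n l : ℕ} (p : ℝ × ℝ) (w w' : Fin (n + 1) → MIdx l → ℝ)
    (h : ∀ a μ, ¬ (a = 0 ∧ μ = MIdx.zero l) → w a μ = w' a μ) :
    (p, w') = jetShift (w' 0 (MIdx.zero l) - w 0 (MIdx.zero l)) (p, w) := by
  refine Prod.ext (by simp [jetShift]) (funext fun a => funext fun μ => ?_)
  simp only [jetShift, Prod.snd_add, Pi.add_apply]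
  by_cases ha : a = 0
  · subst ha
    by_cases hμ : μ = MIdx.zero l
    · subst hμ
      simp
    · simp [hμ, h 0 μ (fun h => hμ h.2)]
  · simp [ha, h a μ (fun h => ha h.1)]

/-- The jet with the value of `U¹` replaced by `0`. -/
def eraseU1 {n l : ℕ} (J : Jet (n + 1) l) : Jet (n + 1) l :=
  jetShift (-(J.2 0 (MIdx.zero l))) J

theorem contDiff_eraseU1 {n l : ℕ} : ContDiff ℝ ∞ (eraseU1 (n := n) (l := l)) := by
  have h1 : ContDiff ℝ ∞ (fun J : Jet (n + 1) l => -(J.2 0 (MIdx.zero l))) := by fun_prop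
  have h2 : ContDiff ℝ ∞ (fun c : ℝ => (Pi.single (0 : Fin (n + 1))
      (Pi.single (MIdx.zero l) c) : Fin (n + 1) → MIdx l → ℝ)) :=
    (ContinuousLinearMap.single ℝ (fun _ : Fin (n + 1) => MIdx l → ℝ) 0).contDiff.comp
      (ContinuousLinearMap.single ℝ (fun _ : MIdx l => ℝ) (MIdx.zero l)).contDiff
  exact contDiff_id.add (contDiff_const.prodMk (h2.comp h1))

theorem eraseU1_jetShift {n l : ℕ} (c : ℝ) (J : Jet (n + 1) l) :
    eraseU1 (jetShift c J) = eraseU1 J := by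
  have h : (jetShift c J).2 0 (MIdx.zero l) = J.2 0 (MIdx.zero l) + c := by simp [jetShift]
  rw [eraseU1, h, jetShift_jetShift, eraseU1]
  congr 1
  ring

/-- The jets that some translation in `U¹` brings into `A`. -/
def saturation {n l : ℕ} (A : Set (Jet (n + 1) l)) : Set (Jet (n + 1) l) :=
  {J | ∃ c : ℝ, jetShift c J ∈ A}

theorem isOpen_saturation {n l : ℕ} {A : Set (Jet (n + 1) l)} (hA : IsOpen A) :
    IsOpen (saturation A) := by
  have : saturation A = ⋃ c : ℝ, jetShift c ⁻¹' A := by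
    ext J
    simp [saturation]
  rw [this]
  exact isOpen_iUnion fun c => hA.preimage (continuous_jetShift c)

theorem subset_saturation {n l : ℕ} (A : Set (Jet (n + 1) l)) : A ⊆ saturation A :=
  fun J hJ => ⟨0, by rwa [jetShift_zero]⟩

theorem jetShift_mem_saturation {n l : ℕ} {A : Set (Jet (n + 1) l)} {J : Jet (n + 1) l} (c : ℝ) :
    jetShift c J ∈ saturation A ↔ J ∈ saturation A := by
  constructor
  · rintro ⟨d, hd⟩
    exact ⟨c + d, by rwa [← jetShift_jetShift]⟩
  · rintro ⟨d, hd⟩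
    exact ⟨d - c, by rwa [jetShift_jetShift, add_sub_cancel]⟩

/-- Every family of open sets of jets gives rise to a system without `U¹` whose equations are
violated exactly at the jets that some translation in `U¹` brings into the respective set. -/
theorem exists_freeOfU1 {n l s : ℕ} {O : Set (Jet (n + 1) l)} (hO : IsOpen O)
    (A : Fin s → Set (Jet (n + 1) l)) (hA : ∀ σ, IsOpen (A σ)) :
    ∃ S' : PDESystem (n + 1) l s, S'.FreeOfU1 ∧ S'.dom = saturation O ∧
      ∀ J, S'.R J = 0 ↔ ∀ σ, J ∉ saturation (A σ) := by
  choose f hsupp hf using fun σ =>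
    (isOpen_saturation (hA σ)).exists_contDiff_support_eq (n := (⊤ : ℕ∞))
  refine ⟨{ dom := saturation O, isOpen_dom := isOpen_saturation hO,
            R := fun J σ => f σ (eraseU1 J),
            contDiffOn_R := (contDiff_pi.2 fun σ =>
              (hf σ).1.comp contDiff_eraseU1).contDiffOn }, ?_, rfl, ?_⟩
  · intro p w w' h hw
    rw [jetShift_eq_of_forall_ne p w w' h]
    refine ⟨(jetShift_mem_saturation _).2 hw, ?_⟩
    simp only [eraseU1_jetShift]
  · intro J
    rw [funext_iff]
    refine forall_congr' fun σ => ?_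
    have h1 : eraseU1 J ∈ saturation (A σ) ↔ J ∈ saturation (A σ) := jetShift_mem_saturation _
    rw [← h1, ← hsupp σ, Function.mem_support, not_not]
    rfl

theorem jet_mem_of_corresponds {k l s : ℕ} {S : PDESystem k l s}
    {Φ : OpenPartialHomeomorph (Base k) (Base k)} {P : Jet k l → Jet k l}
    (hP : ∀ D u D' U, Corresponds Φ D u D' U → ∀ q ∈ D',
      jet l u (baseMap Φ U q) = P (jet l U q))
    {D D' : Set (ℝ × ℝ)} {u U : ℝ × ℝ → Fin k → ℝ} (h : Corresponds Φ D u D' U)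
    (hdom : ∀ q ∈ D', P (jet l U q) ∈ S.dom) : ∀ p ∈ D, jet l u p ∈ S.dom := by
  intro p hp
  obtain ⟨q, hq, rfl⟩ := h.exists_baseMap_eq hp
  rw [hP D u D' U h q hq]
  exact hdom q hq

/-- Near a point whose jet is the prolongation of a jet in the domain of `S`, all small
translates of `U` come from functions with jets in the domain of `S`, over a common
neighbourhood. -/
theorem exists_corresponds_family_dom {n l s : ℕ} (hl : 1 ≤ l) {S : PDESystem (n + 1) l s}
    {Φ : OpenPartialHomeomorph (Base (n + 1)) (Base (n + 1))}
    (hΦ : ContDiffOn ℝ ∞ Φ.symm Φ.target) {P : Jet (n + 1) l → Jet (n + 1) l}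
    (hPc : ContinuousOn P (prolDom Φ l))
    (hP : ∀ D u D' U, Corresponds Φ D u D' U → ∀ q ∈ D',
      jet l u (baseMap Φ U q) = P (jet l U q))
    {D' : Set (ℝ × ℝ)} {U : ℝ × ℝ → Fin (n + 1) → ℝ} (hD' : IsOpen D')
    (hU : ContDiffOn ℝ ∞ U D') {q₀ : ℝ × ℝ} (hq₀ : q₀ ∈ D')
    (h : jet l U q₀ ∈ prolDom Φ l ∩ P ⁻¹' S.dom) :
    ∃ D₀ ⊆ D', IsOpen D₀ ∧ q₀ ∈ D₀ ∧ ∃ δ > 0, ∀ c : ℝ, |c| < δ →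
      ∃ D u, Corresponds Φ D u D₀ (shift c U) ∧ ∀ p ∈ D, jet l u p ∈ S.dom := by
  have hO : IsOpen (prolDom Φ l ∩ P ⁻¹' S.dom) :=
    hPc.isOpen_inter_preimage (isOpen_prolDom hΦ l) S.isOpen_dom
  have hcont : ContinuousAt (fun w : (ℝ × ℝ) × ℝ => jetShift w.2 (jet l U w.1)) (q₀, 0) := by
    have h1 : ContinuousAt (jet l U) q₀ :=
      (contDiffOn_jet hD' hU l).continuousOn.continuousAt (hD'.mem_nhds hq₀)
    have h2 : Continuous (fun c : ℝ => ((0 : ℝ × ℝ), (Pi.single (0 : Fin (n + 1))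
        (Pi.single (MIdx.zero l) c) : Fin (n + 1) → MIdx l → ℝ))) :=
      continuous_const.prodMk ((continuous_single (A := fun _ : Fin (n + 1) => MIdx l → ℝ) 0).comp
        (continuous_single (A := fun _ : MIdx l => ℝ) (MIdx.zero l)))
    have h3 : ContinuousAt (fun w : (ℝ × ℝ) × ℝ => jet l U w.1) (q₀, 0) :=
      ContinuousAt.comp (x := (q₀, (0 : ℝ))) (g := jet l U) h1 continuousAt_fst
    exact h3.add
      (h2.comp continuous_snd).continuousAt
  have hW : (fun w : (ℝ × ℝ) × ℝ => jetShift w.2 (jet l U w.1)) ⁻¹'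
      (prolDom Φ l ∩ P ⁻¹' S.dom) ∈ nhds (q₀, (0 : ℝ)) := by
    refine hcont.preimage_mem_nhds (hO.mem_nhds ?_)
    simpa only [jetShift_zero] using h
  obtain ⟨D₀, hsub, hD₀, hq₀D₀, δ, hδ, hfam⟩ := exists_corresponds_family hΦ hD' hU hq₀
    (base_mem_of_mem_prolDom h.1) (injective_fderiv_baseMap_of_mem_prolDom hΦ hD' hU hq₀ hl h.1) hW
  refine ⟨D₀, hsub, hD₀, hq₀D₀, δ, hδ, fun c hc => ?_⟩
  obtain ⟨hcW, D, u, hDu⟩ := hfam c hc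
  refine ⟨D, u, hDu, jet_mem_of_corresponds hP hDu fun q hq => ?_⟩
  rw [jet_shift]
  exact (hcW q hq).2

/-- The domain of the transformed system is saturated under translations in `U¹`, and
its equation number `σ` is violated by a jet if some translate of the jet is the prolongation of
one that violates equation number `σ` of `S`. The zero set of `R^σ` itself need not be invariant
under the prolonged group, as only the solutions are assumed to be permuted, and not every jet in
the zero set need belong to a solution; this is why all translates have to be taken into account.
-/
theorem exists_invertiblyEquivalent {n l s : ℕ} (hl : 1 ≤ l) {S : PDESystem (n + 1) l s}
    {G : PointGroup (n + 1)} (hG : IsPointSymmetry G S) (K : CanonicalCoordinates G) :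
    ∃ S' : PDESystem (n + 1) l s, S'.FreeOfU1 ∧ InvertiblyEquivalent S K.Φ S' := by
  obtain ⟨P, hPc, hP⟩ := exists_prolongation K.smooth K.smooth_symm l
  set O : Set (Jet (n + 1) l) := prolDom K.Φ l ∩ P ⁻¹' S.dom with hOdef
  have hO : IsOpen O := hPc.isOpen_inter_preimage (isOpen_prolDom K.smooth_symm l) S.isOpen_dom
  let A : Fin s → Set (Jet (n + 1) l) := fun σ => O ∩ {J | S.R (P J) σ ≠ 0}
  have hA : ∀ σ, IsOpen (A σ) := fun σ => by
    have hc : ContinuousOn (fun J => S.R (P J) σ) O :=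
      (continuousOn_pi.1 S.contDiffOn_R.continuousOn σ).comp (hPc.mono inter_subset_left)
        fun J hJ => hJ.2
    exact hc.isOpen_inter_preimage hO isOpen_ne
  obtain ⟨S', hfree, hdom, hR⟩ := exists_freeOfU1 hO A hA
  refine ⟨S', hfree, ⟨?_, ?_⟩⟩
  · intro D u D' U hc hdomu
    have hjet : ∀ q ∈ D', jet l U q ∈ O := fun q hq => by
      refine ⟨hc.jet_mem_prolDom K.smooth K.smooth_symm hq l, ?_⟩
      rw [mem_preimage, ← hP D u D' U hc q hq]
      exact hdomu _ (hc.baseMap_mem hq).1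
    constructor
    · intro hu
      refine ⟨hc.2.2.1, hc.2.2.2.1, fun q hq => ⟨hdom ▸ subset_saturation O (hjet q hq), ?_⟩⟩
      rw [hR]
      rintro σ ⟨c, hcO, hne⟩
      -- The translate of `U` by `c` comes from a function `v`, which solves `S` by symmetry.
      rw [← jet_shift] at hcO hne
      obtain ⟨D₀, hsub, hD₀, hq₀, δ, hδ, hfam⟩ := exists_corresponds_family_dom hl K.smooth_symm
        hPc hP hc.2.2.1 (contDiffOn_shift hc.2.2.2.1 c) hq hcO
      obtain ⟨D₁, v, hv, hvdom⟩ := hfam 0 (by simpa using hδ)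
      rw [shift_zero] at hv
      obtain ⟨hu₀, hsubD⟩ := hc.mono K.smooth hD₀ hsub
      have husol : S.IsSolution (baseMap K.Φ U '' D₀) u :=
        ⟨hu₀.1, hu₀.2.1, fun p hp => hu.2.2 p (hsubD hp)⟩
      have hvsol := isSolution_of_corresponds_shift hG K husol hu₀ hv hvdom
      refine hne ?_
      rw [← hP D₁ v D₀ _ hv q hq₀, (hvsol.2.2 _ (hv.baseMap_mem hq₀).1).2]
      rfl
    · intro hU
      refine ⟨hc.1, hc.2.1, fun p hp => ⟨hdomu p hp, ?_⟩⟩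
      obtain ⟨q, hq, rfl⟩ := hc.exists_baseMap_eq hp
      have h1 := (hR _).1 (hU.2.2 q hq).2
      funext σ
      by_contra hne
      rw [hP D u D' U hc q hq] at hne
      exact h1 σ (subset_saturation _ ⟨hjet q hq, hne⟩)
  · intro D' U hU q hq
    have h1 := (hU.2.2 q hq).1
    rw [hdom] at h1
    obtain ⟨c, hcO⟩ := h1
    rw [← jet_shift] at hcO
    obtain ⟨D₀, hsub, hD₀, hq₀, δ, hδ, hfam⟩ := exists_corresponds_family_dom hl K.smooth_symm
      hPc hP hU.1 (contDiffOn_shift hU.2.1 c) hq hcO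
    obtain ⟨D, v, hv, hvdom⟩ := hfam 0 (by simpa using hδ)
    rw [shift_zero] at hv
    refine ⟨D₀, hsub, hq₀, c, D, v, hv, hv.1, hv.2.1, fun p hp => ⟨hvdom p hp, ?_⟩⟩
    obtain ⟨r, hr, rfl⟩ := hv.exists_baseMap_eq hp
    have h2 := (hR _).1 (hU.2.2 r (hsub hr)).2
    have hrO : jet l (shift c U) r ∈ O := by
      refine ⟨hv.jet_mem_prolDom K.smooth K.smooth_symm hr l, ?_⟩
      rw [mem_preimage, ← hP D v D₀ _ hv r hr]
      exact hvdom _ hp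
    funext σ
    by_contra hne
    rw [hP D v D₀ _ hv r hr] at hne
    exact h2 σ ⟨c, by rw [← jet_shift]; exact ⟨hrO, hne⟩⟩

/-! ### The inverse potential system -/

theorem PDESystem.IsSolution.congr {k l s : ℕ} {S : PDESystem k l s} {D : Set (ℝ × ℝ)}
    {u v : ℝ × ℝ → Fin k → ℝ} (hu : S.IsSolution D u) (h : EqOn v u D) : S.IsSolution D v :=
  ⟨hu.1, hu.2.1.congr h, fun p hp => by rw [jet_congr hu.1 h l hp]; exact hu.2.2 p hp⟩

theorem PDESystem.IsSolution.mono {k l s : ℕ} {S : PDESystem k l s} {D D₀ : Set (ℝ × ℝ)}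
    {u : ℝ × ℝ → Fin k → ℝ} (hu : S.IsSolution D u) (hD₀ : IsOpen D₀) (h : D₀ ⊆ D) :
    S.IsSolution D₀ u :=
  ⟨hD₀, hu.2.1.mono h, fun p hp => hu.2.2 p (h hp)⟩

theorem PDESystem.FreeOfU1.isSolution_shift {n l s : ℕ} {S : PDESystem (n + 1) l s}
    (hS : S.FreeOfU1) {D : Set (ℝ × ℝ)} {U : ℝ × ℝ → Fin (n + 1) → ℝ}
    (hU : S.IsSolution D U) (c : ℝ) : S.IsSolution D (shift c U) := by
  refine ⟨hU.1, contDiffOn_shift hU.2.1 c, fun p hp => ?_⟩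
  obtain ⟨h1, h2⟩ := hU.2.2 p hp
  have h3 := hS p (jet l U p).2 (jet l (shift c U) p).2 (fun a μ h => ?_) h1
  · exact ⟨h3.1, h3.2.symm.trans h2⟩
  · rw [jet_shift]
    simp only [jetShift, Prod.snd_add, Pi.add_apply]
    by_cases ha : a = 0
    · subst ha
      have hμ : μ ≠ MIdx.zero l := fun hμ => h ⟨rfl, hμ⟩
      simp [hμ]
    · simp [ha]

theorem contDiffOn_dropU1 {n : ℕ} {U : ℝ × ℝ → Fin (n + 1) → ℝ} {D : Set (ℝ × ℝ)}
    (hD : IsOpen D) (hU : ContDiffOn ℝ ∞ U D) : ContDiffOn ℝ ∞ (dropU1 U) D := by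
  refine contDiffOn_pi.2 fun a => ?_
  refine Fin.cases ?_ (fun a => Fin.cases ?_ (fun i => ?_) a) a
  · exact (contDiffOn_component hU 0).pdT hD
  · exact (contDiffOn_component hU 0).pdX hD
  · exact contDiffOn_component hU i.succ

theorem Set.EqOn.dropU1 {n : ℕ} {U V : ℝ × ℝ → Fin (n + 1) → ℝ} {D : Set (ℝ × ℝ)}
    (h : EqOn U V D) (hD : IsOpen D) : EqOn (dropU1 U) (dropU1 V) D := by
  intro p hp
  have h0 : EqOn (fun q => U q 0) (fun q => V q 0) D := fun q hq => congrFun (h hq) 0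
  simp only [_root_.dropU1, h0.pdT hD hp, h0.pdX hD hp, h hp]

/-- Substituting the derivatives of `U¹` for `α` and `β` gives back the jet of `U`, apart from the
value of `U¹`, whichever way the mixed derivatives are expressed. -/
theorem substAlphaBeta_jet_dropU1 {n l : ℕ} (κ : MIdx l → Bool) {D : Set (ℝ × ℝ)}
    {U : ℝ × ℝ → Fin (n + 1) → ℝ} (hD : IsOpen D) (hU : ContDiffOn ℝ ∞ U D) {p : ℝ × ℝ}
    (hp : p ∈ D) (a : Fin (n + 1)) (μ : MIdx l) (h : ¬ (a = 0 ∧ μ = MIdx.zero l)) :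
    (substAlphaBeta κ (jet l (dropU1 U) p)).2 a μ = (jet l U p).2 a μ := by
  have hU0 := contDiffOn_component hU 0
  have hα : (μ.1.2 : ℕ) ≠ 0 → (jet l (dropU1 U) p).2 0 μ.predT = (jet l U p).2 0 μ := by
    intro hj
    change pd (μ.1.1 : ℕ) ((μ.1.2 : ℕ) - 1) (pdT fun q => U q 0) p
      = pd (μ.1.1 : ℕ) (μ.1.2 : ℕ) (fun q => U q 0) p
    rw [pd_pdT, Nat.sub_add_cancel (Nat.one_le_iff_ne_zero.2 hj)]
  have hβ : (μ.1.1 : ℕ) ≠ 0 → (jet l (dropU1 U) p).2 1 μ.predX = (jet l U p).2 0 μ := by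
    intro hi
    change pd ((μ.1.1 : ℕ) - 1) (μ.1.2 : ℕ) (pdX fun q => U q 0) p
      = pd (μ.1.1 : ℕ) (μ.1.2 : ℕ) (fun q => U q 0) p
    rw [pd_pdX hU0 hD _ _ hp, Nat.sub_add_cancel (Nat.one_le_iff_ne_zero.2 hi)]
  revert h
  refine Fin.cases (fun h => ?_) (fun i _ => rfl) a
  simp only [substAlphaBeta, Fin.cons_zero]
  by_cases hi : (μ.1.1 : ℕ) = 0
  · have hj : (μ.1.2 : ℕ) ≠ 0 := fun hj => h ⟨rfl, by
      ext
      · simpa [MIdx.zero] using hi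
      · simpa [MIdx.zero] using hj⟩
    rw [if_pos hi, if_neg hj, hα hj]
  · rw [if_neg hi]
    split_ifs with hc
    · exact hβ hi
    · exact hα fun hj => hc (Or.inl hj)

theorem inversePotentialSystem_R_eq_zero {n l s : ℕ} (hl : 1 ≤ l) (κ : MIdx l → Bool)
    (S : PDESystem (n + 1) l s) (J : Jet (n + 2) l) :
    (inversePotentialSystem hl κ S).R J = 0 ↔
      J.2 0 (MIdx.oneX hl) = J.2 1 (MIdx.oneT hl) ∧ S.R (substAlphaBeta κ J) = 0 := by
  rw [funext_iff, Fin.forall_fin_succ, ← sub_eq_zero (a := J.2 0 (MIdx.oneX hl)), funext_iff]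
  rfl

theorem inversePotentialSystem_closed {n l s : ℕ} {hl : 1 ≤ l} {κ : MIdx l → Bool}
    {S : PDESystem (n + 1) l s} {D : Set (ℝ × ℝ)} {w : ℝ × ℝ → Fin (n + 2) → ℝ}
    (hw : (inversePotentialSystem hl κ S).IsSolution D w) :
    EqOn (pdX fun q => w q 0) (pdT fun q => w q 1) D := fun p hp =>
  ((inversePotentialSystem_R_eq_zero hl κ S _).1 (hw.2.2 p hp).2).1

/-- As `U¹` does not occur in `S`, the inverse potential system expresses that `U` solves `S` through
the derivatives of `U¹` alone. -/
theorem isSolution_dropU1_iff {n l s : ℕ} (hl : 1 ≤ l) (κ : MIdx l → Bool)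
    {S : PDESystem (n + 1) l s} (hS : S.FreeOfU1) {D : Set (ℝ × ℝ)}
    {U : ℝ × ℝ → Fin (n + 1) → ℝ} (hU : ContDiffOn ℝ ∞ U D) :
    (inversePotentialSystem hl κ S).IsSolution D (dropU1 U) ↔ S.IsSolution D U := by
  constructor
  · rintro ⟨hD, -, h⟩
    refine ⟨hD, hU, fun p hp => ?_⟩
    obtain ⟨h1, h2⟩ := h p hp
    rw [inversePotentialSystem_R_eq_zero] at h2
    obtain ⟨h3, h4⟩ := hS p (substAlphaBeta κ (jet l (dropU1 U) p)).2 (jet l U p).2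
      (substAlphaBeta_jet_dropU1 κ hD hU hp) h1
    exact ⟨h3, h4.symm.trans h2.2⟩
  · rintro ⟨hD, -, h⟩
    refine ⟨hD, contDiffOn_dropU1 hD hU, fun p hp => ?_⟩
    obtain ⟨h1, h2⟩ := h p hp
    obtain ⟨h3, h4⟩ := hS p (jet l U p).2 (substAlphaBeta κ (jet l (dropU1 U) p)).2
      (fun a μ ha => (substAlphaBeta_jet_dropU1 κ hD hU hp a μ ha).symm) h1
    refine ⟨h3, (inversePotentialSystem_R_eq_zero hl κ S _).2 ⟨?_, h4.symm.trans h2⟩⟩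
    exact pdX_pdT_comm (contDiffOn_component hU 0) hD hp

theorem contDiffOn_withU1 {n : ℕ} {g : ℝ × ℝ → ℝ} {w : ℝ × ℝ → Fin (n + 2) → ℝ}
    {D : Set (ℝ × ℝ)} (hg : ContDiffOn ℝ ∞ g D) (hw : ContDiffOn ℝ ∞ w D) :
    ContDiffOn ℝ ∞ (withU1 g w) D := by
  refine contDiffOn_pi.2 fun a => ?_
  refine Fin.cases ?_ (fun i => ?_) a
  · exact hg
  · exact contDiffOn_component hw i.succ.succ

theorem eqOn_dropU1_withU1_iff {n : ℕ} {g : ℝ × ℝ → ℝ} {w : ℝ × ℝ → Fin (n + 2) → ℝ}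
    {D : Set (ℝ × ℝ)} :
    EqOn w (dropU1 (withU1 g w)) D ↔
      EqOn (pdX g) (fun q => w q 1) D ∧ EqOn (pdT g) (fun q => w q 0) D := by
  constructor
  · intro h
    exact ⟨fun p hp => (congrFun (h hp) 1).symm, fun p hp => (congrFun (h hp) 0).symm⟩
  · rintro ⟨hX, hT⟩ p hp
    funext a
    refine Fin.cases ?_ (fun a => Fin.cases ?_ (fun i => ?_) a) a
    · exact (hT hp).symm
    · exact (hX hp).symm
    · rfl

theorem isSolution_withU1 {n l s : ℕ} {hl : 1 ≤ l} {κ : MIdx l → Bool}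
    {S : PDESystem (n + 1) l s} (hS : S.FreeOfU1) {D : Set (ℝ × ℝ)}
    {w : ℝ × ℝ → Fin (n + 2) → ℝ} (hw : (inversePotentialSystem hl κ S).IsSolution D w)
    {g : ℝ × ℝ → ℝ} (hg : ContDiffOn ℝ ∞ g D) (h : EqOn w (dropU1 (withU1 g w)) D) :
    S.IsSolution D (withU1 g w) :=
  (isSolution_dropU1_iff hl κ hS (contDiffOn_withU1 hg hw.2.1)).1 (hw.congr h.symm)

theorem exists_potential_of_isSolution {n l s : ℕ} {hl : 1 ≤ l} {κ : MIdx l → Bool}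
    {S : PDESystem (n + 1) l s} (hS : S.FreeOfU1) {D : Set (ℝ × ℝ)}
    (hsc : IsSimplyConnected D) {w : ℝ × ℝ → Fin (n + 2) → ℝ}
    (hw : (inversePotentialSystem hl κ S).IsSolution D w) :
    ∃ h : ℝ × ℝ → ℝ, ContDiffOn ℝ ∞ h D ∧ ∀ g : ℝ × ℝ → ℝ,
      (S.IsSolution D (withU1 g w) ∧ EqOn w (dropU1 (withU1 g w)) D) ↔
        ∃ C : ℝ, ∀ p ∈ D, g p = h p + C := by
  obtain ⟨h, hh, hX, hT⟩ := exists_potential hw.1 hsc (contDiffOn_component hw.2.1 0)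
    (contDiffOn_component hw.2.1 1) (inversePotentialSystem_closed hw)
  refine ⟨h, hh, fun g => ⟨?_, ?_⟩⟩
  · rintro ⟨hsol, heq⟩
    obtain ⟨hgX, hgT⟩ := eqOn_dropU1_withU1_iff.1 heq
    exact exists_eq_add_const hw.1 hsc.isPathConnected.isConnected.isPreconnected hh
      (contDiffOn_component hsol.2.1 0) (hX.trans hgX.symm) (hT.trans hgT.symm)
  · rintro ⟨C, hC⟩
    have hC' : EqOn g (fun p => h p + C) D := hC
    have heq : EqOn w (dropU1 (withU1 g w)) D := by
      rw [eqOn_dropU1_withU1_iff]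
      refine ⟨(hC'.pdX hw.1).trans ?_, (hC'.pdT hw.1).trans ?_⟩
      · rw [pdX_add_const]; exact hX
      · rw [pdT_add_const]; exact hT
    exact ⟨isSolution_withU1 hS hw ((hh.add contDiffOn_const).congr hC') heq, heq⟩

/-! ### Nonlocal relation -/

section Nonlocal

variable {n l s : ℕ} {S S' : PDESystem (n + 1) l s} {G : PointGroup (n + 1)}

/-- Over a small neighbourhood, all functions that differ from a solution by a small constant in
`U¹` are solutions of the original system as well. -/
theorem exists_solution_family (hl : 1 ≤ l) (K : CanonicalCoordinates G) (hS' : S'.FreeOfU1)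
    (hE : InvertiblyEquivalent S K.Φ S') {D D' : Set (ℝ × ℝ)}
    {u U : ℝ × ℝ → Fin (n + 1) → ℝ} (hu : S.IsSolution D u) (hc : Corresponds K.Φ D u D' U)
    {q : ℝ × ℝ} (hq : q ∈ D') :
    ∃ D₀ ⊆ D', q ∈ D₀ ∧ ∃ δ > 0, ∀ c : ℝ, |c| < δ →
      ∃ D u, S.IsSolution D u ∧ Corresponds K.Φ D u D₀ (shift c U) := by
  obtain ⟨P, hPc, hP⟩ := exists_prolongation K.smooth K.smooth_symm l
  have hdom : ∀ p ∈ D, jet l u p ∈ S.dom := fun p hp => (hu.2.2 p hp).1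
  have hU : S'.IsSolution D' U := (hE.iff D u D' U hc hdom).1 hu
  have hjet : jet l U q ∈ prolDom K.Φ l ∩ P ⁻¹' S.dom := by
    refine ⟨hc.jet_mem_prolDom K.smooth K.smooth_symm hq l, ?_⟩
    rw [mem_preimage, ← hP D u D' U hc q hq]
    exact hdom _ (hc.baseMap_mem hq).1
  obtain ⟨D₀, hsub, hD₀, hq₀, δ, hδ, hfam⟩ := exists_corresponds_family_dom hl K.smooth_symm
    hPc hP hU.1 hU.2.1 hq hjet
  refine ⟨D₀, hsub, hq₀, δ, hδ, fun c hcδ => ?_⟩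
  obtain ⟨D₁, v, hv, hvdom⟩ := hfam c hcδ
  exact ⟨D₁, v, (hE.iff D₁ v D₀ _ hv hvdom).2 (hS'.isSolution_shift (hU.mono hD₀ hsub) c), hv⟩

/-- A solution of the inverse potential system has a potential `U¹` on a ball; a translate of the
resulting `U` comes from a solution of the original system, and so do all its small translates. -/
theorem exists_backward (hl : 1 ≤ l) (K : CanonicalCoordinates G) (hS' : S'.FreeOfU1)
    (hE : InvertiblyEquivalent S K.Φ S') (κ : MIdx l → Bool) {D' : Set (ℝ × ℝ)}
    {w : ℝ × ℝ → Fin (n + 2) → ℝ} (hw : (inversePotentialSystem hl κ S').IsSolution D' w)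
    {p : ℝ × ℝ} (hp : p ∈ D') :
    ∃ D₀ ⊆ D', p ∈ D₀ ∧ ∃ (U : ℝ × ℝ → Fin (n + 1) → ℝ) (δ : ℝ), 0 < δ ∧
      EqOn w (dropU1 U) D₀ ∧
      ∀ c : ℝ, |c| < δ → ∃ D u, S.IsSolution D u ∧ Corresponds K.Φ D u D₀ (shift c U) ∧
        Linked K.Φ D u D₀ w := by
  obtain ⟨r, hr, hball⟩ := Metric.isOpen_iff.1 hw.1 p hp
  have hsc : IsSimplyConnected (Metric.ball p r) := by
    have := (convex_ball p r).contractibleSpace ⟨p, Metric.mem_ball_self hr⟩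
    exact SimplyConnectedSpace.ofContractible _
  have hwB := hw.mono Metric.isOpen_ball hball
  obtain ⟨h, -, hh⟩ := exists_potential_of_isSolution hS' hsc hwB
  obtain ⟨hsol, heq⟩ := (hh h).2 ⟨0, fun p _ => (add_zero _).symm⟩
  obtain ⟨D₁, hD₁, hpD₁, c₀, D, u, hc, hu⟩ := hE.lift _ _ hsol p (Metric.mem_ball_self hr)
  obtain ⟨D₀, hD₀, hpD₀, δ, hδ, hfam⟩ := exists_solution_family hl K hS' hE hu hc hpD₁
  have heq' : ∀ c, EqOn w (dropU1 (shift c (shift c₀ (withU1 h w)))) D₀ := fun c => by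
    rw [dropU1_shift, dropU1_shift]
    exact heq.mono (hD₀.trans hD₁)
  refine ⟨D₀, (hD₀.trans hD₁).trans hball, hpD₀, shift c₀ (withU1 h w), δ, hδ, ?_, fun c hcδ => ?_⟩
  · simpa only [shift_zero] using heq' 0
  · obtain ⟨D₂, v, hv, hvc⟩ := hfam c hcδ
    exact ⟨D₂, v, hv, hvc, _, hvc, heq' c⟩

theorem disjoint_graphOver_of_ne {Φ : OpenPartialHomeomorph (Base (n + 1)) (Base (n + 1))}
    {D₁ D₂ D₀ : Set (ℝ × ℝ)} {u₁ u₂ U : ℝ × ℝ → Fin (n + 1) → ℝ} {c₁ c₂ : ℝ}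
    (h₁ : Corresponds Φ D₁ u₁ D₀ (shift c₁ U)) (h₂ : Corresponds Φ D₂ u₂ D₀ (shift c₂ U))
    (hne : c₁ ≠ c₂) : Disjoint (graphOver D₁ u₁) (graphOver D₂ u₂) := by
  rw [disjoint_left]
  intro z hz₁ hz₂
  have hz₁' : Φ z ∈ graphOver D₀ (shift c₁ U) := h₁.2.2.2.2.2 ▸ mem_image_of_mem Φ hz₁
  have hz₂' : Φ z ∈ graphOver D₀ (shift c₂ U) := h₂.2.2.2.2.2 ▸ mem_image_of_mem Φ hz₂
  obtain ⟨q₁, -, hq₁⟩ := hz₁'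
  obtain ⟨q₂, -, hq₂⟩ := hz₂'
  have h := hq₁.trans hq₂.symm
  simp only [Prod.mk.injEq] at h
  obtain ⟨rfl, h⟩ := h
  have h0 := congrFun h 0
  rw [shift_apply_zero, shift_apply_zero] at h0
  exact hne (add_left_cancel h0)

theorem nonlocallyRelated_inversePotentialSystem (hl : 1 ≤ l) (K : CanonicalCoordinates G)
    (hS' : S'.FreeOfU1) (hE : InvertiblyEquivalent S K.Φ S') (κ : MIdx l → Bool) :
    NonlocallyRelated S K.Φ S' (inversePotentialSystem hl κ S') := by
  have hforward : ∀ D u D' w, S.IsSolution D u → Linked K.Φ D u D' w →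
      (inversePotentialSystem hl κ S').IsSolution D' w := by
    rintro D u D' w hu ⟨U, hc, heq⟩
    have hU : S'.IsSolution D' U := (hE.iff D u D' U hc fun p hp => (hu.2.2 p hp).1).1 hu
    exact ((isSolution_dropU1_iff hl κ hS' hU.2.1).2 hU).congr heq
  refine ⟨hforward, ?_, fun D' U hU => (isSolution_dropU1_iff hl κ hS' hU.2.1).2 hU,
    fun D' w hsc hw => exists_potential_of_isSolution hS' hsc hw,
    fun D' w hw p hp => exists_backward hl K hS' hE κ hw hp, ?_, ?_, ?_⟩
  · intro D u hu p hp hsrc hbij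
    obtain ⟨D₁, hsub, hD₁, hp₁, δ, hδ, hfam⟩ := exists_corresponds_family (Φ := K.Φ.symm)
      (by simpa using K.smooth) hu.1 hu.2.1 hp hsrc hbij.injective Filter.univ_mem
    obtain ⟨-, D', U, hc⟩ := hfam 0 (by simpa using hδ)
    rw [shift_zero] at hc
    have hlink : Linked K.Φ D₁ u D' (dropU1 U) := ⟨U, hc.symm, fun _ _ => rfl⟩
    exact ⟨D₁, hsub, hp₁, D', dropU1 U, hlink,
      hforward _ _ _ _ (hu.mono hD₁ hsub) hlink⟩
  · intro D₁ u₁ D₂ u₂ D' U₁ U₂ hpre _ _ h₁ h₂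
    have hD' := h₁.2.2.1
    constructor
    · intro heq
      obtain ⟨c, hc⟩ := exists_eq_add_const hD' hpre (contDiffOn_component h₁.2.2.2.1 0)
        (contDiffOn_component h₂.2.2.2.1 0) (fun p hp => congrFun (heq hp) 1)
        (fun p hp => congrFun (heq hp) 0)
      refine ⟨c, fun p hp => funext fun a => Fin.cases ?_ (fun i => ?_) a⟩
      · rw [shift_apply_zero, hc p hp]
      · rw [shift_apply_succ]
        exact (congrFun (heq hp) i.succ.succ).symm
    · rintro ⟨c, hc⟩
      have := hc.dropU1 hD'
      rw [dropU1_shift] at this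
      exact this.symm
  · intro D' w hw p hp
    obtain ⟨D₀, hsub, hp₀, U, δ, hδ, -, hfam⟩ := exists_backward hl K hS' hE κ hw hp
    obtain ⟨D₁, u₁, hu₁, hc₁, hl₁⟩ := hfam 0 (by simpa using hδ)
    obtain ⟨D₂, u₂, hu₂, hc₂, hl₂⟩ := hfam (δ / 2) (by rw [abs_of_pos] <;> linarith)
    exact ⟨D₀, hsub, hp₀, D₁, u₁, D₂, u₂, hu₁, hu₂, hl₁, hl₂,
      disjoint_graphOver_of_ne hc₁ hc₂ (half_pos hδ).ne⟩
  · intro k F D u D' U hu hc hne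
    obtain ⟨q, hq⟩ := hne
    obtain ⟨D₀, hsub, hq₀, δ, hδ, hfam⟩ := exists_solution_family hl K hS' hE hu hc hq
    -- The value of `F` is the same for all translates of `U`, so it is wrong for one of any two.
    obtain ⟨c, hcδ, hcne⟩ : ∃ c : ℝ, |c| < δ ∧ U q 0 + c ≠ F (jet k (dropU1 U) q) := by
      by_cases h0 : U q 0 + 0 = F (jet k (dropU1 U) q)
      · refine ⟨δ / 2, by rw [abs_of_pos] <;> linarith, fun h => ?_⟩
        linarith
      · exact ⟨0, by simpa using hδ, h0⟩
    obtain ⟨D₁, v, hv, hvc⟩ := hfam c hcδ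
    refine ⟨D₀, hsub, D₁, v, shift c U, hv, hvc, ⟨c, fun _ _ => rfl⟩, q, hq₀, ?_⟩
    rw [shift_apply_zero, dropU1_shift]
    exact hcne

end Nonlocal

theorem theorem1 {n l s : ℕ} (hl : 1 ≤ l) (S : PDESystem (n + 1) l s)
    (G : PointGroup (n + 1)) (hG : IsPointSymmetry G S) :
    (∀ z ∈ G.M, G.generator z ≠ 0 →
      ∃ K : CanonicalCoordinates G, z ∈ K.Φ.source) ∧
    ∀ K : CanonicalCoordinates G,
      (∃ S' : PDESystem (n + 1) l s, S'.FreeOfU1 ∧ InvertiblyEquivalent S K.Φ S') ∧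
      ∀ S' : PDESystem (n + 1) l s, S'.FreeOfU1 → InvertiblyEquivalent S K.Φ S' →
        ∀ κ : MIdx l → Bool,
          NonlocallyRelated S K.Φ S' (inversePotentialSystem hl κ S') :=
  ⟨fun _ hz hne => exists_canonicalCoordinates G hz hne, fun K =>
    ⟨exists_invertiblyEquivalent hl hG K, fun _ hS' hE κ =>
      nonlocallyRelated_inversePotentialSystem hl K hS' hE κ⟩⟩
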